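/- Let $f:\mathbb R\to\mathbb C$ be an arbitrary function and let $H$ be an infinite-dimensional complex Hilbert space. Let $\boldsymbol S_1$ denote the class of trace class operators on $H$, that is, of bounded operators $T$ such that $\sum_i\langle |T|e_i,e_i\rangle<\infty$ for an orthonormal basis $(e_i)$ of $H$, where $|T|=(T^*T)^{1/2}$. For a compact self-adjoint operator $A$ on $H$, let $P_t$ be the orthogonal projection onto $\ker(A-tI)$ and put $f(A)=\sum_t f(t)P_t$, the sum being taken over all eigenvalues $t$ of $A$; the domain of $f(A)$ consists of those $x\in H$ for which $\sum_t f(t)P_tx$ converges unconditionally, and it is all of $H$ (with $f(A)$ bounded) whenever $f$ is bounded on the set of eigenvalues of $A$. For such $A$ and $B$, we write $f(A)-f(B)\in\boldsymbol S_1$ if the difference is defined on a dense subspace (the intersection of the domains of $f(A)$ and $f(B)$) and coincides there with an operator of trace class. A function $f$ is called operator Lipschitz on a closed bounded set $\mathfrak F\subset\mathbb R$ if there is a constant $C$ such that $$\|f(A)-f(B)\|\le C\,\|A-B\|$$ for all self-adjoint operators $A$ and $B$, on an arbitrary complex Hilbert space, whose spectra are contained in $\mathfrak F$. (Taking scalar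 operators one sees that such an $f$ is Lipschitz on $\mathfrak F$, in particular continuous on $\mathfrak F$, so that $f(A)$ and $f(B)$ are defined by the continuous functional calculus.) **Theorem.** The following statements are equivalent: (a) the implication $$A-B\in\boldsymbol S_1\ \Longrightarrow\ f(A)-f(B)\in\boldsymbol S_1$$ holds for arbitrary compact self-adjoint operators $A$ and $B$ on $H$; (b) there exists a number $\delta>0$ such that the restriction of $f$ to $[-\delta,\delta]$ is operator Lipschitz on $[-\delta,\delta]$. -/

import Mathlib

universe u v

/-- A bounded operator `T` on a complex Hilbert space is of trace class if
`∑ ⟪|T| b i, b i⟫ < ∞` for some Hilbert basis `b`, where `|T| = (T* T)^(1/2)`.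
(The sum of these nonnegative numbers does not depend on the Hilbert basis.) -/
def IsTraceClass {H : Type u} [NormedAddCommGroup H] [InnerProductSpace ℂ H] [CompleteSpace H]
    (T : H →L[ℂ] H) : Prop :=
  ∃ (w : Set H) (b : HilbertBasis w ℂ H),
    Summable fun i : w => (inner ℂ (CFC.abs T (b i)) (b i)).re

/-- A densely defined operator `T` is of trace class if it agrees on its domain with a bounded
operator of trace class. -/
def IsTraceClassPMap {H : Type u} [NormedAddCommGroup H] [InnerProductSpace ℂ H]
    [CompleteSpace H] (T : H →ₗ.[ℂ] H) : Prop :=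
  Dense (T.domain : Set H) ∧
    ∃ S : H →L[ℂ] H, IsTraceClass S ∧ ∀ x : T.domain, T x = S (x : H)

/-- The orthogonal projection onto the eigenspace `{x | A x = t x}` of `A`, for real `t`
(it is `0` if `t` is not an eigenvalue). -/
noncomputable def eigenProj {H : Type u} [NormedAddCommGroup H] [InnerProductSpace ℂ H]
    [CompleteSpace H] (A : H →L[ℂ] H) (t : ℝ) : H →L[ℂ] H :=
  (Module.End.eigenspace (A : Module.End ℂ H) (t : ℂ)).starProjection

/-- The operator `f(A) = ∑ f(t) P_t`, the sum being over all eigenvalues `t` of the compact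
self-adjoint operator `A` (including `0`, if `0` is one), for an arbitrary function `f` on the
real line. Its domain consists of all `x` for which the orthogonal series `∑ f(t) P_t x`
converges, i.e. `∑ |f(t)|² ‖P_t x‖² < ∞`; it is the whole space when `f` is bounded on the set of
eigenvalues of `A`. -/
noncomputable def compactFunCalc {H : Type u} [NormedAddCommGroup H] [InnerProductSpace ℂ H]
    [CompleteSpace H] (f : ℝ → ℂ) (A : H →L[ℂ] H) : H →ₗ.[ℂ] H where
  domain :=
    { carrier := {x | Summable fun t : ℝ => f t • eigenProj A t x}
      add_mem' := fun {x y} hx hy => by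
        have h := Summable.add hx hy
        simpa only [Set.mem_ofPred_eq, map_add, smul_add] using h
      zero_mem' := by simp
      smul_mem' := fun c x hx => by
        have h := Summable.const_smul c hx
        simpa only [Set.mem_ofPred_eq, map_smul, smul_comm c] using h }
  toFun :=
    { toFun := fun x => ∑' t : ℝ, f t • eigenProj A t (x : H)
      map_add' := fun x y => by
        have h := Summable.tsum_add x.2 y.2
        simpa only [Submodule.coe_add, map_add, smul_add] using h
      map_smul' := fun c x => by
        have h := Summable.tsum_const_smul c x.2
        simpa only [Submodule.coe_smul, map_smul, smul_comm c, RingHom.id_apply] using h }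

/-- `f` is operator Lipschitz on the bounded set `F ⊆ ℝ`: there is a constant `C` such that
`‖f(A) - f(B)‖ ≤ C ‖A - B‖` for all self-adjoint operators `A`, `B` on any complex Hilbert space
with spectra in `F` (as `F` is bounded, such operators are bounded). Here `f(A)` is the continuous
functional calculus, taken over `ℂ` because `f` is complex-valued. Taking scalar multiples of the
identity for `A` and `B` one sees that such an `f` is Lipschitz, hence continuous, on `F`, so that
`f(A)` and `f(B)` are always the genuine functions of `A` and `B`. -/
def IsOperatorLipschitzOn (f : ℝ → ℂ) (F : Set ℝ) : Prop :=
  ∃ C : ℝ, ∀ (H : Type v) [NormedAddCommGroup H] [InnerProductSpace ℂ H] [CompleteSpace H]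
    (A B : H →L[ℂ] H), IsSelfAdjoint A → IsSelfAdjoint B →
    spectrum ℝ A ⊆ F → spectrum ℝ B ⊆ F →
    ‖cfc (fun z : ℂ => f z.re) A - cfc (fun z : ℂ => f z.re) B‖ ≤ C * ‖A - B‖

/-!
The proof compares two Lipschitz estimates for `f` on the self-adjoint operators of norm at most
`δ`: one in the operator norm, the other in the trace norm. Each implies the other, up to the
constant and the radius, and the trace norm estimate amounts to the preservation of trace class
perturbations.

*Duality.* Take operators on finite-dimensional spaces. A Lipschitz estimate
`N (f(A) - f(B)) ≤ C N (A - B)` in a unitarily invariant norm `N`, applied to `A` and `U A U*`,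
bounds the commutator of `f(A)` with a unitary `U` by that of `A`. A Cayley transform replaces `U`
by a self-adjoint operator, and a `2 × 2` block matrix yields
`N (f(A) X - X f(B)) ≤ 8 C N (A X - X B)` for all `X`
(`SymmetricNorm.LipschitzFor.quasicommutator`). If `A` and `B` have no common eigenvalue, every
`W` is of the form `X A - B X`, and the identity
`Tr ((f(A) - f(B)) (X A - B X)) = Tr ((A - B) (X f(A) - f(B) X))` (`opTrace_sub_mul_sub`) turns
the estimate into a Lipschitz estimate in the norm dual to `N`. Common eigenvalues are removed by
a small shift, and the result is `SymmetricNorm.LipschitzFor.dual`. The operator norm and the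
trace norm are dual to each other, so it can be used in both directions.

*Passage to Hilbert spaces.* The trace norm is handled through the relation `TraceNormLE`, which
only involves traces of finite-dimensional compressions and holds with some bound exactly for the
trace class operators. Both norms are determined by compressions, and polynomials in `A` and `B`
can be computed, on a given finite-dimensional subspace, in a larger finite-dimensional subspace.
With polynomial approximation the estimates extend to all Hilbert spaces
(`SymmetricNorm.LipschitzFor.le_opFun_sub`).

*Sufficiency.* Let `f` be operator Lipschitz near `0`. Truncating the compact operators `A` and
`B` to a small interval around `0` changes `A`, `B`, `f(A)` and `f(B)` by operators of finite rank
only, and the trace norm estimate applies to the truncated operators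
(`isTraceClassPMap_of_isOperatorLipschitzOn`).

*Necessity.* If the trace norm estimate fails near `0` for every constant, there are pairs of
operators on finite-dimensional spaces, of arbitrarily small norm, whose difference has
arbitrarily small trace norm while the difference of the values of `f` has trace norm greater than
`1`. (Such a pair is found by halving the segment between the two operators, or by taking a direct
sum of copies, to adjust the size of the difference.) The orthogonal direct sum of a sequence of
such pairs is a pair of compact operators whose difference is of trace class, while that of the
values of `f` is not (`exists_lipschitzFor_trace`).
-/

set_option linter.unusedSectionVars false

/-! ### Functions of self-adjoint operators -/

/-- The function `f` of a bounded self-adjoint operator, in the sense of the continuous functional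
calculus over `ℂ`. -/
noncomputable def opFun {E : Type*} [NormedAddCommGroup E] [InnerProductSpace ℂ E]
    [CompleteSpace E] (f : ℝ → ℂ) (A : E →L[ℂ] E) : E →L[ℂ] E :=
  cfc (fun z : ℂ => f z.re) A

section opFun

variable {E F : Type*} [NormedAddCommGroup E] [InnerProductSpace ℂ E] [CompleteSpace E]
  [NormedAddCommGroup F] [InnerProductSpace ℂ F] [CompleteSpace F]

theorem IsSelfAdjoint.eq_ofReal_re_of_mem_spectrum {A : E →L[ℂ] E} (hA : IsSelfAdjoint A) {z : ℂ}
    (hz : z ∈ spectrum ℂ A) : z = (z.re : ℂ) :=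
  hA.mem_spectrum_eq_re hz

theorem opFun_eq_aeval {A : E →L[ℂ] E} (hA : IsSelfAdjoint A) {f : ℝ → ℂ} {p : Polynomial ℂ}
    (h : ∀ z ∈ spectrum ℂ A, f z.re = p.eval z) : opFun f A = Polynomial.aeval A p := by
  rw [opFun, cfc_congr (g := p.eval) (fun z hz => h z hz), cfc_polynomial p A hA.isStarNormal]

theorem finite_spectrum_of_finiteDimensional [FiniteDimensional ℂ E] (A : E →L[ℂ] E) :
    (spectrum ℂ A).Finite := by
  have hint : IsIntegral ℂ (ContinuousLinearMap.toLinearMap A) := Algebra.IsIntegral.isIntegral _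
  have e := AlgEquiv.spectrum_eq (Module.End.toContinuousLinearMap E (𝕜 := ℂ)).symm A
  rw [← e]
  exact Module.End.finite_spectrum _

theorem comp_aeval_of_comp_eq {A : E →L[ℂ] E} {B : F →L[ℂ] F} {J : E →L[ℂ] F}
    (h : J ∘L A = B ∘L J) (p : Polynomial ℂ) :
    J ∘L Polynomial.aeval A p = Polynomial.aeval B p ∘L J := by
  induction p using Polynomial.induction_on with
  | C a => ext x; simp [Algebra.algebraMap_eq_smul_one]
  | add p q hp hq => simp [ContinuousLinearMap.comp_add, hp, hq]
  | monomial n a ih =>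
    have e1 : Polynomial.aeval A (Polynomial.C a * Polynomial.X ^ (n + 1)) =
      Polynomial.aeval A (Polynomial.C a * Polynomial.X ^ n) * A := by
      rw [pow_succ, ← mul_assoc, map_mul, Polynomial.aeval_X]
    have e2 : Polynomial.aeval B (Polynomial.C a * Polynomial.X ^ (n + 1)) =
      Polynomial.aeval B (Polynomial.C a * Polynomial.X ^ n) * B := by
      rw [pow_succ, ← mul_assoc, map_mul, Polynomial.aeval_X]
    rw [e1, e2, ContinuousLinearMap.mul_def, ContinuousLinearMap.mul_def,
      ← ContinuousLinearMap.comp_assoc, ih, ContinuousLinearMap.comp_assoc, h,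
      ContinuousLinearMap.comp_assoc]

theorem exists_polynomial_eq_on_finite (f : ℝ → ℂ) {s : Set ℂ} (hs : s.Finite) :
    ∃ p : Polynomial ℂ, ∀ z ∈ s, f z.re = p.eval z := by
  refine ⟨Lagrange.interpolate hs.toFinset id (fun z => f z.re), fun z hz => ?_⟩
  exact (Lagrange.eval_interpolate_at_node (fun z : ℂ => f z.re) (Set.injOn_id _)
    (hs.mem_toFinset.2 hz)).symm

/-- An operator intertwining two self-adjoint operators on finite-dimensional spaces intertwines
all their functions, which are polynomials in them. -/
theorem comp_opFun_of_comp_eq [FiniteDimensional ℂ E] [FiniteDimensional ℂ F] (f : ℝ → ℂ)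
    {A : E →L[ℂ] E} {B : F →L[ℂ] F} (hA : IsSelfAdjoint A) (hB : IsSelfAdjoint B)
    {J : E →L[ℂ] F} (h : J ∘L A = B ∘L J) : J ∘L opFun f A = opFun f B ∘L J := by
  obtain ⟨p, hp⟩ := exists_polynomial_eq_on_finite f
    ((finite_spectrum_of_finiteDimensional A).union (finite_spectrum_of_finiteDimensional B))
  rw [opFun_eq_aeval hA fun z hz => hp z (Or.inl hz),
    opFun_eq_aeval hB fun z hz => hp z (Or.inr hz), comp_aeval_of_comp_eq h]

theorem aeval_apply_eq_smul {A : E →L[ℂ] E} {t : ℂ} {x : E} (hx : A x = t • x)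
    (p : Polynomial ℂ) : Polynomial.aeval A p x = p.eval t • x := by
  -- The map `z ↦ z x` intertwines multiplication by `t` on `ℂ` with `A`.
  have h := comp_aeval_of_comp_eq (A := t • (1 : ℂ →L[ℂ] ℂ)) (B := A)
    (J := ContinuousLinearMap.toSpanSingleton ℂ x) (by ext; simp [hx]) p
  have h1 := congrArg (fun T => T 1) h
  have h2 : Polynomial.aeval (t • (1 : ℂ →L[ℂ] ℂ)) p = (p.eval t) • (1 : ℂ →L[ℂ] ℂ) := by
    rw [← Algebra.algebraMap_eq_smul_one, Polynomial.aeval_algebraMap_apply]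
    simp [Algebra.algebraMap_eq_smul_one]
  rw [h2] at h1
  simpa using h1.symm

theorem mem_spectrum_of_apply_eq_smul {A : E →L[ℂ] E} {t : ℂ} {x : E} (hx : A x = t • x)
    (hx0 : x ≠ 0) : t ∈ spectrum ℂ A := by
  intro h
  obtain ⟨S, hS⟩ := h.exists_left_inv
  have := congrArg (fun T => T x) hS
  simp [hx, Algebra.algebraMap_eq_smul_one] at this
  exact hx0 this.symm

theorem opFun_apply_eq_smul_of_finiteDimensional [FiniteDimensional ℂ E] (f : ℝ → ℂ)
    {A : E →L[ℂ] E} (hA : IsSelfAdjoint A) {t : ℝ} {x : E} (hx : A x = (t : ℂ) • x) :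
    opFun f A x = f t • x := by
  rcases eq_or_ne x 0 with rfl | hx0
  · simp
  obtain ⟨p, hp⟩ := exists_polynomial_eq_on_finite f (finite_spectrum_of_finiteDimensional A)
  rw [opFun_eq_aeval hA hp, aeval_apply_eq_smul hx,
    ← hp _ (mem_spectrum_of_apply_eq_smul hx hx0), Complex.ofReal_re]

theorem norm_re_le_of_mem_spectrum {A : E →L[ℂ] E} {δ : ℝ} (hδ : ‖A‖ ≤ δ) {z : ℂ}
    (hz : z ∈ spectrum ℂ A) : z.re ∈ Set.Icc (-δ) δ := by
  rcases subsingleton_or_nontrivial (E →L[ℂ] E) with h | h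
  · simp [spectrum.of_subsingleton] at hz
  · exact abs_le.1 ((Complex.abs_re_le_norm z).trans ((spectrum.norm_le_norm_of_mem hz).trans hδ))

theorem spectrum_real_subset_of_norm_le {A : E →L[ℂ] E} {δ : ℝ} (hδ : ‖A‖ ≤ δ) :
    spectrum ℝ A ⊆ Set.Icc (-δ) δ := by
  intro t ht
  have : (t : ℂ) ∈ spectrum ℂ A := by
    rw [← spectrum.algebraMap_mem_iff ℂ] at ht
    simpa using ht
  simpa using norm_re_le_of_mem_spectrum hδ this

theorem norm_le_of_spectrum_real_subset {A : E →L[ℂ] E} (hA : IsSelfAdjoint A) {δ : ℝ}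
    (hδ0 : 0 ≤ δ) (hδ : spectrum ℝ A ⊆ Set.Icc (-δ) δ) : ‖A‖ ≤ δ := by
  rw [← cfc_id ℝ A]
  exact norm_cfc_le hδ0 fun t ht => abs_le.2 (hδ ht)

/-- Uniform polynomial approximation of a complex-valued continuous function of a real variable. -/
theorem exists_polynomial_near_complex {f : ℝ → ℂ} {δ : ℝ}
    (hf : ContinuousOn f (Set.Icc (-δ) δ)) {ε : ℝ} (hε : 0 < ε) :
    ∃ p : Polynomial ℂ, ∀ t ∈ Set.Icc (-δ) δ, ‖f t - p.eval (t : ℂ)‖ ≤ ε := by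
  obtain ⟨p, hp⟩ := exists_polynomial_near_of_continuousOn (-δ) δ (fun t => (f t).re)
    (Complex.continuous_re.comp_continuousOn hf) (ε / 2) (by positivity)
  obtain ⟨q, hq⟩ := exists_polynomial_near_of_continuousOn (-δ) δ (fun t => (f t).im)
    (Complex.continuous_im.comp_continuousOn hf) (ε / 2) (by positivity)
  refine ⟨p.map (algebraMap ℝ ℂ) + Polynomial.C Complex.I * q.map (algebraMap ℝ ℂ), fun t ht => ?_⟩
  have e1 : ∀ r : Polynomial ℝ, (r.map (algebraMap ℝ ℂ)).eval (t : ℂ) = ((r.eval t : ℝ) : ℂ) := by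
    intro r
    exact Polynomial.eval_map_algebraMap r _ |>.trans (Polynomial.aeval_algebraMap_apply ℂ t r)
  rw [Polynomial.eval_add, Polynomial.eval_mul, Polynomial.eval_C, e1, e1]
  refine (Complex.norm_le_abs_re_add_abs_im _).trans ?_
  have h1 := (hp t ht).le
  have h2 := (hq t ht).le
  rw [abs_sub_comm] at h1 h2
  simp only [Complex.sub_re, Complex.sub_im, Complex.add_re, Complex.add_im, Complex.ofReal_re,
    Complex.ofReal_im, Complex.mul_re, Complex.mul_im, Complex.I_re, Complex.I_im]
  simp only [zero_mul, one_mul, mul_zero, sub_zero, zero_add, add_zero]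
  linarith

theorem continuousOn_comp_re_spectrum {f : ℝ → ℂ} {δ : ℝ} (hf : ContinuousOn f (Set.Icc (-δ) δ))
    {A : E →L[ℂ] E} (hδ : ‖A‖ ≤ δ) : ContinuousOn (fun z : ℂ => f z.re) (spectrum ℂ A) :=
  hf.comp Complex.continuous_re.continuousOn fun _ hz => norm_re_le_of_mem_spectrum hδ hz

theorem norm_opFun_sub_aeval_le {f : ℝ → ℂ} {δ : ℝ} (hf : ContinuousOn f (Set.Icc (-δ) δ))
    {A : E →L[ℂ] E} (hA : IsSelfAdjoint A) (hδ : ‖A‖ ≤ δ) {p : Polynomial ℂ} {ε : ℝ} (hε : 0 ≤ ε)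
    (hp : ∀ t ∈ Set.Icc (-δ) δ, ‖f t - p.eval (t : ℂ)‖ ≤ ε) :
    ‖opFun f A - Polynomial.aeval A p‖ ≤ ε := by
  have := hA.isStarNormal
  rw [opFun, ← cfc_polynomial p A, ← cfc_sub _ _ A (continuousOn_comp_re_spectrum hf hδ)]
  refine norm_cfc_le hε fun z hz => ?_
  have h := hp _ (norm_re_le_of_mem_spectrum hδ hz)
  rwa [← hA.eq_ofReal_re_of_mem_spectrum hz] at h

theorem opFun_apply_eq_smul {f : ℝ → ℂ} {δ : ℝ} (hf : ContinuousOn f (Set.Icc (-δ) δ))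
    {A : E →L[ℂ] E} (hA : IsSelfAdjoint A) (hδ : ‖A‖ ≤ δ) {t : ℝ} {x : E}
    (hx : A x = (t : ℂ) • x) : opFun f A x = f t • x := by
  rcases eq_or_ne x 0 with rfl | hx0
  · simp
  have ht := norm_re_le_of_mem_spectrum hδ (mem_spectrum_of_apply_eq_smul hx hx0)
  rw [Complex.ofReal_re] at ht
  refine eq_of_forall_dist_le fun ε hε => ?_
  obtain ⟨p, hp⟩ := exists_polynomial_near_complex hf (ε := ε / (2 * ‖x‖))
    (by have := norm_pos_iff.2 hx0; positivity)
  have h1 := (ContinuousLinearMap.le_opNorm (opFun f A - Polynomial.aeval A p) x).trans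
    (mul_le_mul_of_nonneg_right (norm_opFun_sub_aeval_le hf hA hδ (by positivity) hp)
      (norm_nonneg x))
  have h2 : ‖p.eval (t : ℂ) • x - f t • x‖ ≤ ε / (2 * ‖x‖) * ‖x‖ := by
    rw [← sub_smul, norm_smul, norm_sub_rev]
    exact mul_le_mul_of_nonneg_right (hp t ht) (norm_nonneg x)
  rw [sub_apply, aeval_apply_eq_smul hx] at h1
  have h3 : ε / (2 * ‖x‖) * ‖x‖ = ε / 2 := by
    have := norm_pos_iff.2 hx0
    field_simp
  rw [dist_eq_norm]
  calc _ ≤ _ := norm_sub_le_norm_sub_add_norm_sub _ (p.eval (t : ℂ) • x) _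
    _ ≤ ε := by rw [h3] at h1 h2; linarith

end opFun

/-! ### Traces and the trace norm -/

section trace

variable {E F H K : Type*} [NormedAddCommGroup E] [InnerProductSpace ℂ E]
  [NormedAddCommGroup F] [InnerProductSpace ℂ F]
  [NormedAddCommGroup H] [InnerProductSpace ℂ H]
  [NormedAddCommGroup K] [InnerProductSpace ℂ K]

/-- The trace of an operator; it is meaningful on finite-dimensional spaces only. -/
noncomputable def opTrace (T : E →L[ℂ] E) : ℂ := LinearMap.trace ℂ E (T : E →ₗ[ℂ] E)

theorem opTrace_add (S T : E →L[ℂ] E) : opTrace (S + T) = opTrace S + opTrace T := by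
  simp [opTrace]

theorem opTrace_sub (S T : E →L[ℂ] E) : opTrace (S - T) = opTrace S - opTrace T := by
  simp [opTrace]

theorem opTrace_smul (c : ℂ) (T : E →L[ℂ] E) : opTrace (c • T) = c * opTrace T := by
  simp [opTrace]

theorem opTrace_sum {ι : Type*} (s : Finset ι) (T : ι → E →L[ℂ] E) :
    opTrace (∑ i ∈ s, T i) = ∑ i ∈ s, opTrace (T i) := by
  classical
  induction s using Finset.induction_on with
  | empty => simp [opTrace]
  | insert a s ha ih => rw [Finset.sum_insert ha, Finset.sum_insert ha, opTrace_add, ih]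

theorem opTrace_comp_comm [FiniteDimensional ℂ E] [FiniteDimensional ℂ F] (S : E →L[ℂ] F)
    (T : F →L[ℂ] E) : opTrace (S ∘L T) = opTrace (T ∘L S) := by
  rw [opTrace, opTrace, ContinuousLinearMap.toLinearMap_comp, LinearMap.trace_comp_comm',
    ContinuousLinearMap.toLinearMap_comp]

theorem opTrace_eq_sum {ι : Type*} [Fintype ι] (b : OrthonormalBasis ι ℂ E) (T : E →L[ℂ] E) :
    opTrace T = ∑ i, inner ℂ (b i) (T (b i)) := by
  rw [opTrace, LinearMap.trace_eq_sum_inner _ b]; rfl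

theorem norm_opTrace_le [FiniteDimensional ℂ E] (T : E →L[ℂ] E) :
    ‖opTrace T‖ ≤ Module.finrank ℂ E * ‖T‖ := by
  rw [opTrace_eq_sum (stdOrthonormalBasis ℂ E)]
  refine (norm_sum_le _ _).trans ((Finset.sum_le_card_nsmul _ _ ‖T‖ fun i _ => ?_).trans ?_)
  · refine (norm_inner_le_norm _ _).trans ?_
    have := T.le_opNorm (stdOrthonormalBasis ℂ E i)
    simpa using this
  · simp

theorem norm_comp_comp_le_of_le_one {Y : H →L[ℂ] F} {X : E →L[ℂ] K} (hY : ‖Y‖ ≤ 1) (hX : ‖X‖ ≤ 1)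
    (T : K →L[ℂ] H) : ‖Y ∘L T ∘L X‖ ≤ ‖T‖ :=
  (ContinuousLinearMap.opNorm_comp_le _ _).trans ((mul_le_of_le_one_left (norm_nonneg _) hY).trans
    ((ContinuousLinearMap.opNorm_comp_le _ _).trans (mul_le_of_le_one_right (norm_nonneg _) hX)))

theorem opTrace_rankOne_comp [FiniteDimensional ℂ E] (x y : E) (T : E →L[ℂ] E) :
    opTrace (T ∘L InnerProductSpace.rankOne ℂ x y) = inner ℂ y (T x) := by
  rw [InnerProductSpace.comp_rankOne, opTrace, InnerProductSpace.trace_rankOne]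

/-- `TraceNormLE T M` says that the trace norm of `T` is at most `M`: every finite-dimensional
compression `Y T X` of `T` by contractions `X` and `Y` has trace of modulus at most `M`. -/
def TraceNormLE (T : H →L[ℂ] H) (M : ℝ) : Prop :=
  ∀ (n : ℕ) (X : EuclideanSpace ℂ (Fin n) →L[ℂ] H) (Y : H →L[ℂ] EuclideanSpace ℂ (Fin n)),
    ‖X‖ ≤ 1 → ‖Y‖ ≤ 1 → ‖opTrace (Y ∘L T ∘L X)‖ ≤ M

namespace TraceNormLE

theorem nonneg {T : H →L[ℂ] H} {M : ℝ} (h : TraceNormLE T M) : 0 ≤ M :=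
  (norm_nonneg _).trans (h 0 0 0 (by simp) (by simp))

theorem mono {T : H →L[ℂ] H} {M N : ℝ} (h : TraceNormLE T M) (hMN : M ≤ N) : TraceNormLE T N :=
  fun n X Y hX hY => (h n X Y hX hY).trans hMN

theorem add {S T : H →L[ℂ] H} {M N : ℝ} (hS : TraceNormLE S M) (hT : TraceNormLE T N) :
    TraceNormLE (S + T) (M + N) := fun n X Y hX hY => by
  rw [ContinuousLinearMap.add_comp, ContinuousLinearMap.comp_add, opTrace_add]
  exact (norm_add_le _ _).trans (add_le_add (hS n X Y hX hY) (hT n X Y hX hY))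

protected theorem zero : TraceNormLE (0 : H →L[ℂ] H) 0 := fun n X Y _ _ => by
  simp [opTrace]

theorem sum {ι : Type*} (s : Finset ι) {T : ι → H →L[ℂ] H} {M : ι → ℝ}
    (h : ∀ i ∈ s, TraceNormLE (T i) (M i)) : TraceNormLE (∑ i ∈ s, T i) (∑ i ∈ s, M i) := by
  classical
  induction s using Finset.induction_on with
  | empty => simpa using TraceNormLE.zero
  | insert a s ha ih =>
    rw [Finset.sum_insert ha, Finset.sum_insert ha]
    exact (h a (by simp)).add (ih fun i hi => h i (by simp [hi]))

theorem smul {T : H →L[ℂ] H} {M : ℝ} (h : TraceNormLE T M) (c : ℂ) :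
    TraceNormLE (c • T) (‖c‖ * M) := fun n X Y hX hY => by
  rw [ContinuousLinearMap.smul_comp, ContinuousLinearMap.comp_smul, opTrace_smul, norm_mul]
  exact mul_le_mul_of_nonneg_left (h n X Y hX hY) (norm_nonneg c)

theorem neg {T : H →L[ℂ] H} {M : ℝ} (h : TraceNormLE T M) : TraceNormLE (-T) M := by
  simpa using h.smul (-1)

theorem sub {S T : H →L[ℂ] H} {M N : ℝ} (hS : TraceNormLE S M) (hT : TraceNormLE T N) :
    TraceNormLE (S - T) (M + N) := by
  rw [sub_eq_add_neg]
  exact hS.add hT.neg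

theorem comp_of_norm_le_one {T : H →L[ℂ] H} {M : ℝ} (h : TraceNormLE T M) {Y : H →L[ℂ] K}
    {X : K →L[ℂ] H} (hY : ‖Y‖ ≤ 1) (hX : ‖X‖ ≤ 1) : TraceNormLE (Y ∘L T ∘L X) M := by
  intro n X' Y' hX' hY'
  refine h n (X ∘L X') (Y' ∘L Y) ((ContinuousLinearMap.opNorm_comp_le _ _).trans ?_)
    ((ContinuousLinearMap.opNorm_comp_le _ _).trans ?_)
  · exact mul_le_one₀ hX (norm_nonneg _) hX'
  · exact mul_le_one₀ hY' (norm_nonneg _) hY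

theorem comp {T : H →L[ℂ] H} {M : ℝ} (h : TraceNormLE T M) (Y : H →L[ℂ] K) (X : K →L[ℂ] H) :
    TraceNormLE (Y ∘L T ∘L X) (‖Y‖ * ‖X‖ * M) := by
  rcases eq_or_ne Y 0 with rfl | hY
  · simpa using TraceNormLE.zero
  rcases eq_or_ne X 0 with rfl | hX
  · simpa using TraceNormLE.zero
  have hY' := norm_pos_iff.2 hY
  have hX' := norm_pos_iff.2 hX
  have h1 := (h.comp_of_norm_le_one (Y := ((‖Y‖ : ℂ)⁻¹) • Y) (X := ((‖X‖ : ℂ)⁻¹) • X)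
    (by simp [norm_smul, hY]) (by simp [norm_smul, hX])).smul ((‖Y‖ : ℂ) * ‖X‖)
  convert! h1 using 1
  · simp only [ContinuousLinearMap.smul_comp, ContinuousLinearMap.comp_smul, smul_smul]
    rw [mul_assoc, mul_inv_cancel_left₀ (by simpa using hX),
      mul_inv_cancel₀ (by simpa using hY), one_smul]
  · simp

/-- The trace norm is lower semicontinuous for the operator norm. -/
theorem of_tendsto {ι : Type*} {l : Filter ι} [l.NeBot] {S : ι → H →L[ℂ] H} {T : H →L[ℂ] H} {M : ℝ}
    (hS : ∀ᶠ i in l, TraceNormLE (S i) M) (hT : Filter.Tendsto S l (nhds T)) :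
    TraceNormLE T M := by
  intro n X Y hX hY
  have hc : Continuous fun T : H →L[ℂ] H => ‖opTrace (Y ∘L T ∘L X)‖ := by
    have e : ∀ T : H →L[ℂ] H, opTrace (Y ∘L T ∘L X) = ∑ i,
        inner ℂ (EuclideanSpace.basisFun (Fin n) ℂ i) (Y (T (X (EuclideanSpace.basisFun _ ℂ i)))) :=
      fun T => opTrace_eq_sum _ _
    simp only [e]
    fun_prop
  exact le_of_tendsto ((hc.tendsto T).comp hT) (hS.mono fun i hi => hi n X Y hX hY)

theorem hasSum {T : ℕ → H →L[ℂ] H} {S : H →L[ℂ] H} (hS : HasSum T S) {M : ℕ → ℝ} {a : ℝ}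
    (hM : HasSum M a) (h : ∀ i, TraceNormLE (T i) (M i)) : TraceNormLE S a :=
  of_tendsto (l := Filter.atTop) (.of_forall fun s => (sum s fun i _ => h i).mono
    (sum_le_hasSum s (fun i _ => (h i).nonneg) hM)) hS

theorem of_forall_pos {T : H →L[ℂ] H} {M c : ℝ} {ε₀ : ℝ} (hε₀ : 0 < ε₀)
    (h : ∀ ε, 0 < ε → ε < ε₀ → TraceNormLE T (M + c * ε)) : TraceNormLE T M := by
  intro n X Y hX hY
  have ht : Filter.Tendsto (fun ε : ℝ => M + c * ε) (nhdsWithin 0 (Set.Ioi 0)) (nhds M) := by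
    have : Continuous fun ε : ℝ => M + c * ε := by fun_prop
    simpa using (this.tendsto 0).mono_left nhdsWithin_le_nhds
  refine ge_of_tendsto ht ?_
  filter_upwards [Ioo_mem_nhdsGT hε₀] with ε hε
  exact h ε hε.1 hε.2 n X Y hX hY

/-- On a finite-dimensional space the trace norm is the norm dual to the operator norm. -/
theorem of_forall_opTrace [FiniteDimensional ℂ E] {T : E →L[ℂ] E} {M : ℝ}
    (h : ∀ W : E →L[ℂ] E, ‖W‖ ≤ 1 → ‖opTrace (T ∘L W)‖ ≤ M) : TraceNormLE T M := by
  intro n X Y hX hY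
  rw [opTrace_comp_comm, ContinuousLinearMap.comp_assoc]
  exact h _ ((ContinuousLinearMap.opNorm_comp_le _ _).trans (mul_le_one₀ hX (norm_nonneg _) hY))

theorem norm_opTrace_comp_le_of_norm_le_one [FiniteDimensional ℂ E] {T : E →L[ℂ] E} {M : ℝ}
    (h : TraceNormLE T M) {W : E →L[ℂ] E} (hW : ‖W‖ ≤ 1) : ‖opTrace (T ∘L W)‖ ≤ M := by
  set b := stdOrthonormalBasis ℂ E
  let J : E →L[ℂ] EuclideanSpace ℂ (Fin (Module.finrank ℂ E)) :=
    b.repr.toLinearIsometry.toContinuousLinearMap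
  let J' : EuclideanSpace ℂ (Fin (Module.finrank ℂ E)) →L[ℂ] E :=
    b.repr.symm.toLinearIsometry.toContinuousLinearMap
  have hJ : ‖J‖ ≤ 1 := LinearIsometry.norm_toContinuousLinearMap_le _
  have hJ' : ‖J'‖ ≤ 1 := LinearIsometry.norm_toContinuousLinearMap_le _
  have hJJ : J' ∘L J = ContinuousLinearMap.id ℂ E := by
    ext x
    exact b.repr.symm_apply_apply x
  have h1 := h _ J' (J ∘L W) hJ' ((ContinuousLinearMap.opNorm_comp_le _ _).trans
    (mul_le_one₀ hJ (norm_nonneg _) hW))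
  rw [opTrace_comp_comm, ContinuousLinearMap.comp_assoc, ← ContinuousLinearMap.comp_assoc J', hJJ,
    ContinuousLinearMap.id_comp] at h1
  exact h1

theorem norm_opTrace_comp_le [FiniteDimensional ℂ E] {T : E →L[ℂ] E} {M : ℝ}
    (h : TraceNormLE T M) (W : E →L[ℂ] E) : ‖opTrace (T ∘L W)‖ ≤ M * ‖W‖ := by
  have h1 := h.comp (ContinuousLinearMap.id ℂ E) W
  have h2 := h1.mono (N := M * ‖W‖) (by
    rw [mul_comm M]
    exact mul_le_mul_of_nonneg_right (mul_le_of_le_one_left (norm_nonneg _)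
      (ContinuousLinearMap.norm_id_le)) h.nonneg)
  simpa using h2.norm_opTrace_comp_le_of_norm_le_one (W := ContinuousLinearMap.id ℂ E)
    ContinuousLinearMap.norm_id_le

/-- Operators factoring through a finite-dimensional space have finite trace norm. -/
theorem of_factor [FiniteDimensional ℂ E] (X : E →L[ℂ] H) (Y : H →L[ℂ] E) :
    TraceNormLE (X ∘L Y) (Module.finrank ℂ E * (‖Y‖ * ‖X‖)) := by
  intro n X' Y' hX' hY'
  have e : Y' ∘L (X ∘L Y) ∘L X' = (Y' ∘L X) ∘L (Y ∘L X') := rfl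
  rw [e, opTrace_comp_comm]
  refine (norm_opTrace_le _).trans (mul_le_mul_of_nonneg_left ?_ (by positivity))
  refine (ContinuousLinearMap.opNorm_comp_le _ _).trans ?_
  refine mul_le_mul ?_ ?_ (norm_nonneg _) (norm_nonneg _)
  · exact (ContinuousLinearMap.opNorm_comp_le _ _).trans
      (mul_le_of_le_one_right (norm_nonneg _) hX')
  · exact (ContinuousLinearMap.opNorm_comp_le _ _).trans
      (mul_le_of_le_one_left (norm_nonneg _) hY')

theorem of_finiteDimensional [FiniteDimensional ℂ E] (T : E →L[ℂ] E) :
    TraceNormLE T (Module.finrank ℂ E * ‖T‖) := by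
  refine (of_factor T (ContinuousLinearMap.id ℂ E)).mono ?_
  exact mul_le_mul_of_nonneg_left (mul_le_of_le_one_left (norm_nonneg _)
      (ContinuousLinearMap.norm_id_le)) (by positivity)

theorem rankOne [FiniteDimensional ℂ E] (x y : E) :
    TraceNormLE (InnerProductSpace.rankOne ℂ x y) (‖x‖ * ‖y‖) := by
  refine of_forall_opTrace fun W hW => ?_
  rw [opTrace_comp_comm, opTrace_rankOne_comp, mul_comm ‖x‖]
  refine (norm_inner_le_norm _ _).trans (mul_le_mul_of_nonneg_left ?_ (norm_nonneg _))
  exact (W.le_opNorm x).trans (mul_le_of_le_one_left (norm_nonneg _) hW)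

theorem norm_le [FiniteDimensional ℂ E] {T : E →L[ℂ] E} {M : ℝ} (h : TraceNormLE T M) :
    ‖T‖ ≤ M := by
  refine ContinuousLinearMap.opNorm_le_of_re_inner_le h.nonneg fun x y hx hy => ?_
  have h1 := h.norm_opTrace_comp_le (InnerProductSpace.rankOne ℂ x y)
  rw [opTrace_rankOne_comp, InnerProductSpace.norm_rankOne, hx, hy] at h1
  rw [← inner_conj_symm]
  refine (RCLike.re_le_norm _).trans ?_
  rw [RCLike.norm_conj]
  simpa using h1

theorem adjoint [CompleteSpace H] {T : H →L[ℂ] H} {M : ℝ} (h : TraceNormLE T M) :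
    TraceNormLE (ContinuousLinearMap.adjoint T) M := by
  intro n X Y hX hY
  have h1 := h n (ContinuousLinearMap.adjoint Y) (ContinuousLinearMap.adjoint X)
    (by simpa using hY) (by simpa using hX)
  rw [opTrace_eq_sum (EuclideanSpace.basisFun (Fin n) ℂ)] at h1 ⊢
  rw [← RCLike.norm_conj, map_sum] at h1
  refine le_of_eq_of_le (congrArg _ (Finset.sum_congr rfl fun i _ => ?_)) h1
  simp only [ContinuousLinearMap.comp_apply]
  rw [inner_conj_symm, ContinuousLinearMap.adjoint_inner_left,
    ← ContinuousLinearMap.adjoint_inner_right,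
    ← ContinuousLinearMap.adjoint_inner_left Y]

end TraceNormLE
end trace

/-! ### Trace class operators are those of finite trace norm -/

section traceClass

variable {H : Type*} [NormedAddCommGroup H] [InnerProductSpace ℂ H] [CompleteSpace H]

theorem IsSelfAdjoint.inner_apply {A : H →L[ℂ] H} (hA : IsSelfAdjoint A) (x y : H) :
    inner ℂ (A x) y = inner ℂ x (A y) :=
  hA.isSymmetric x y

theorem norm_abs_apply (T : H →L[ℂ] H) (x : H) : ‖CFC.abs T x‖ = ‖T x‖ := by
  have h1 : CFC.abs T * CFC.abs T = star T * T := CFC.abs_mul_abs T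
  have h2 : IsSelfAdjoint (CFC.abs T) := (CFC.abs_nonneg T).isSelfAdjoint
  have h3 : ContinuousLinearMap.adjoint (CFC.abs T) = CFC.abs T := h2
  have e : ‖CFC.abs T x‖ ^ 2 = ‖T x‖ ^ 2 := by
    rw [ContinuousLinearMap.apply_norm_sq_eq_inner_adjoint_left,
      ContinuousLinearMap.apply_norm_sq_eq_inner_adjoint_left, h3]
    exact congrArg (fun S : H →L[ℂ] H => RCLike.re (inner ℂ (S x) x)) h1
  exact (sq_eq_sq₀ (norm_nonneg _) (norm_nonneg _)).1 e

theorem norm_abs_mul (T X : H →L[ℂ] H) : ‖CFC.abs T * X‖ = ‖T * X‖ := by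
  refine le_antisymm ?_ ?_
  · exact ContinuousLinearMap.opNorm_le_bound _ (norm_nonneg _) fun x =>
      (norm_abs_apply T (X x)).trans_le ((T * X).le_opNorm x)
  · exact ContinuousLinearMap.opNorm_le_bound _ (norm_nonneg _) fun x =>
      (norm_abs_apply T (X x)).symm.trans_le ((CFC.abs T * X).le_opNorm x)

/-- An approximate polar decomposition: `V = T (|T| + ε)⁻¹` is a contraction which nearly maps `|T|`
to `T`, and whose adjoint nearly maps `T` to `|T|`. -/
theorem exists_approx_polar (T : H →L[ℂ] H) {ε : ℝ} (hε : 0 < ε) :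
    ∃ V : H →L[ℂ] H, ‖V‖ ≤ 1 ∧ ‖T - V * CFC.abs T‖ ≤ ε ∧ ‖CFC.abs T - star V * T‖ ≤ ε := by
  set P := CFC.abs T with hP
  have hP0 : 0 ≤ P := CFC.abs_nonneg T
  have hPsa : IsSelfAdjoint P := hP0.isSelfAdjoint
  have hsp : ∀ t ∈ spectrum ℝ P, 0 ≤ t := fun t ht => spectrum_nonneg_of_nonneg hP0 ht
  set g : ℝ → ℝ := fun t => (t + ε)⁻¹ with hg
  have hgc : ContinuousOn g (spectrum ℝ P) := by
    refine ContinuousOn.inv₀ (by fun_prop) fun t ht => ?_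
    have := hsp t ht
    positivity
  set G := cfc g P with hG
  have hGsa : star G = G := cfc_predicate g P
  have hPG : P * G = cfc (fun t => t * g t) P := by
    rw [cfc_mul (fun t : ℝ => t) g P (by fun_prop) hgc, cfc_id' ℝ P]
  have hcomm : P * G = G * P := by
    rw [hPG]
    simp_rw [mul_comm _ (g _)]
    rw [cfc_mul g (fun t : ℝ => t) P hgc (by fun_prop), cfc_id' ℝ P]
  have hD : ‖P - P * G * P‖ ≤ ε := by
    have e : P - P * G * P = cfc (fun t => t - t * g t * t) P := by
      rw [cfc_sub (fun t : ℝ => t) (fun t => t * g t * t) P (by fun_prop) (by fun_prop),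
        cfc_mul (fun t => t * g t) (fun t : ℝ => t) P (by fun_prop) (by fun_prop), ← hPG,
        cfc_id' ℝ P]
    rw [e]
    refine norm_cfc_le hε.le fun t ht => ?_
    have h0 := hsp t ht
    have : t - t * g t * t = ε * (t / (t + ε)) := by
      simp only [hg]; field_simp; ring
    rw [this, Real.norm_of_nonneg (by positivity)]
    exact mul_le_of_le_one_right hε.le (div_le_one_of_le₀ (by linarith) (by positivity))
  have hPP : P * P = star T * T := CFC.abs_mul_abs T
  refine ⟨T * G, ?_, ?_, ?_⟩
  · rw [← norm_abs_mul, ← hP, hPG]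
    refine norm_cfc_le zero_le_one fun t ht => ?_
    have h0 := hsp t ht
    rw [Real.norm_of_nonneg (by positivity), hg, ← div_eq_mul_inv]
    exact div_le_one_of_le₀ (by linarith) (by positivity)
  · have : T - T * G * P = T * (1 - G * P) := by noncomm_ring
    rw [this, ← norm_abs_mul, ← hP]
    convert hD using 2
    noncomm_ring
  · convert hD using 3
    rw [star_mul, hGsa, mul_assoc, ← hPP, ← mul_assoc, hcomm]

theorem HilbertBasis.hasSum_norm_sq {ι : Type*} (b : HilbertBasis ι ℂ H) (x : H) :
    HasSum (fun i => ‖inner ℂ (b i) x‖ ^ 2) (‖x‖ ^ 2) := by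
  have h := Complex.hasSum_re (b.hasSum_inner_mul_inner x x)
  convert h using 1
  · ext i
    rw [← inner_conj_symm x (b i), RCLike.conj_mul]
    norm_cast
  · rw [inner_self_eq_norm_sq_to_K]
    norm_cast

/-- A bound for the Hilbert-Schmidt norm of `R X`, where `R` is self-adjoint and `X` a contraction,
by that of `R`. -/
theorem sum_norm_sq_comp_le {ι : Type*} (b : HilbertBasis ι ℂ H) {R : H →L[ℂ] H}
    (hR : IsSelfAdjoint R) {τ : ℝ} (hτ : HasSum (fun j => ‖R (b j)‖ ^ 2) τ) {n : ℕ}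
    {X : EuclideanSpace ℂ (Fin n) →L[ℂ] H} (hX : ‖X‖ ≤ 1) :
    ∑ i, ‖R (X (EuclideanSpace.basisFun (Fin n) ℂ i))‖ ^ 2 ≤ τ := by
  have h := hasSum_sum (s := Finset.univ) fun i _ =>
    b.hasSum_norm_sq (R (X (EuclideanSpace.basisFun (Fin n) ℂ i)))
  refine hasSum_le (fun j => ?_) h hτ
  have e : ∀ i, ‖inner ℂ (b j) (R (X (EuclideanSpace.basisFun (Fin n) ℂ i)))‖ =
      ‖inner ℂ (EuclideanSpace.basisFun (Fin n) ℂ i) (ContinuousLinearMap.adjoint X (R (b j)))‖ := by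
    intro i
    rw [← hR.inner_apply, ContinuousLinearMap.adjoint_inner_right, norm_inner_symm]
  simp_rw [e]
  rw [OrthonormalBasis.sum_sq_norm_inner_right]
  refine pow_le_pow_left₀ (norm_nonneg _) ?_ 2
  exact (ContinuousLinearMap.le_opNorm _ _).trans
    (mul_le_of_le_one_left (norm_nonneg _) (by simpa using hX))

theorem exists_linearIsometry_of_orthonormal {ι : Type*} [Fintype ι] {v : ι → H}
    (hv : Orthonormal ℂ v) :
    ∃ J : EuclideanSpace ℂ ι →ₗᵢ[ℂ] H, ∀ i, J (EuclideanSpace.basisFun ι ℂ i) = v i := by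
  have h1 : ∀ i, (EuclideanSpace.basisFun ι ℂ).toBasis.constr ℂ v
      ((EuclideanSpace.basisFun ι ℂ).toBasis i) = v i := fun i => Module.Basis.constr_basis _ _ _ _
  refine ⟨LinearMap.isometryOfOrthonormal ((EuclideanSpace.basisFun ι ℂ).toBasis.constr ℂ v)
    (v := (EuclideanSpace.basisFun ι ℂ).toBasis) (by simp [OrthonormalBasis.orthonormal]) ?_, ?_⟩
  · convert hv using 1
    ext i
    exact h1 i
  · intro i
    have e : EuclideanSpace.basisFun ι ℂ i = (EuclideanSpace.basisFun ι ℂ).toBasis i :=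
      (congrFun (OrthonormalBasis.coe_toBasis _) i).symm
    rw [e]
    exact h1 i

/-- Trace class operators have finite trace norm: `T` is nearly `V R R` with a contraction `V` and
`R = |T|^(1/2)` a Hilbert-Schmidt operator, and the Cauchy-Schwarz inequality applies to the trace
of `Y V R R X`. -/
theorem IsTraceClass.exists_traceNormLE {T : H →L[ℂ] H} (h : IsTraceClass T) :
    ∃ M, TraceNormLE T M := by
  obtain ⟨w, b, hb⟩ := h
  set P := CFC.abs T with hP
  have hP0 : 0 ≤ P := CFC.abs_nonneg T
  set R := CFC.sqrt P with hRdef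
  have hR : IsSelfAdjoint R := (CFC.sqrt_nonneg P).isSelfAdjoint
  have hRR : R * R = P := CFC.sqrt_mul_sqrt_self P hP0
  have e : ∀ j, (inner ℂ (P (b j)) (b j)).re = ‖R (b j)‖ ^ 2 := by
    intro j
    rw [← hRR, ← inner_self_eq_norm_sq (𝕜 := ℂ)]
    exact congrArg Complex.re (hR.inner_apply _ _)
  simp_rw [e] at hb
  refine ⟨∑' j, ‖R (b j)‖ ^ 2, fun n X Y hX hY => le_of_forall_pos_le_add fun ε hε => ?_⟩
  obtain ⟨V, hV, hTV, -⟩ := exists_approx_polar T (ε := ε / (n + 1)) (by positivity)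
  have e1 : Y ∘L T ∘L X = Y ∘L (T - V * P) ∘L X + Y ∘L V ∘L R ∘L R ∘L X := by
    rw [← hRR]
    ext x
    simp
  rw [e1, opTrace_add, add_comm]
  refine (norm_add_le _ _).trans (add_le_add ?_ ?_)
  · rw [opTrace_eq_sum (EuclideanSpace.basisFun (Fin n) ℂ)]
    have hYV : ‖ContinuousLinearMap.adjoint (Y ∘L V)‖ ≤ 1 := by
      rw [LinearIsometryEquiv.norm_map]
      exact (ContinuousLinearMap.opNorm_comp_le _ _).trans (mul_le_one₀ hY (norm_nonneg _) hV)
    have h1 := sum_norm_sq_comp_le b hR hb.hasSum hX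
    have h2 := sum_norm_sq_comp_le b hR hb.hasSum hYV
    set d := EuclideanSpace.basisFun (Fin n) ℂ
    have h3 : ∀ i, ‖inner ℂ (d i) ((Y ∘L V ∘L R ∘L R ∘L X) (d i))‖ ≤
        (‖R (X (d i))‖ ^ 2 + ‖R (ContinuousLinearMap.adjoint (Y ∘L V) (d i))‖ ^ 2) / 2 := by
      intro i
      have : inner ℂ (d i) ((Y ∘L V ∘L R ∘L R ∘L X) (d i)) =
          inner ℂ (R (ContinuousLinearMap.adjoint (Y ∘L V) (d i))) (R (X (d i))) := by
        rw [hR.inner_apply, ContinuousLinearMap.adjoint_inner_left]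
        rfl
      rw [this]
      refine (norm_inner_le_norm _ _).trans ?_
      nlinarith [sq_nonneg (‖R (X (d i))‖ - ‖R (ContinuousLinearMap.adjoint (Y ∘L V) (d i))‖)]
    refine (norm_sum_le _ _).trans ((Finset.sum_le_sum fun i _ => h3 i).trans ?_)
    rw [← Finset.sum_div, Finset.sum_add_distrib]
    linarith
  · refine (norm_opTrace_le _).trans ?_
    have h1 : ‖Y ∘L (T - V * P) ∘L X‖ ≤ ε / (n + 1) :=
      (norm_comp_comp_le_of_le_one hY hX _).trans hTV
    rw [finrank_euclideanSpace_fin]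
    calc (n : ℝ) * _ ≤ (n + 1) * (ε / (n + 1)) := by gcongr; linarith
      _ = ε := by field_simp

/-- Operators of finite trace norm are of trace class: the partial sums of `⟪|T| b i, b i⟫` are
traces of compressions of `|T|`, which are close to traces of compressions of `V* T` with `V` from
an approximate polar decomposition. -/
theorem TraceNormLE.isTraceClass {T : H →L[ℂ] H} {M : ℝ} (h : TraceNormLE T M) :
    IsTraceClass T := by
  obtain ⟨w, b, -⟩ := exists_hilbertBasis ℂ H
  set P := CFC.abs T with hP
  have hP0 : 0 ≤ P := CFC.abs_nonneg T
  have hpos : ∀ x, 0 ≤ (inner ℂ (P x) x).re := fun x =>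
    ((ContinuousLinearMap.nonneg_iff_isPositive _).1 hP0).re_inner_nonneg_left x
  refine ⟨w, b, summable_of_sum_le (c := M) (fun i => hpos _) fun s => ?_⟩
  refine le_of_forall_pos_le_add fun ε hε => ?_
  set n := s.card
  let v : Fin n → H := fun i => b (s.equivFin.symm i)
  have hv : Orthonormal ℂ v :=
    b.orthonormal.comp _ (Subtype.val_injective.comp s.equivFin.symm.injective)
  obtain ⟨J, hJ⟩ := exists_linearIsometry_of_orthonormal hv
  set X := J.toContinuousLinearMap with hX
  have hX1 : ‖X‖ ≤ 1 := J.norm_toContinuousLinearMap_le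
  set X' := ContinuousLinearMap.adjoint X
  have hX1' : ‖X'‖ ≤ 1 := by simpa [X'] using hX1
  obtain ⟨V, hV, -, hTV⟩ := exists_approx_polar T (ε := ε / (n + 1)) (by positivity)
  have e1 : X' ∘L P ∘L X = (X' ∘L star V) ∘L T ∘L X + X' ∘L (P - star V * T) ∘L X := by
    ext x
    simp
  have e2 : ((∑ i ∈ s, (inner ℂ (P (b i)) (b i)).re : ℝ) : ℂ).re ≤ ‖opTrace (X' ∘L P ∘L X)‖ := by
    rw [opTrace_eq_sum (EuclideanSpace.basisFun (Fin n) ℂ)]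
    refine le_trans (le_of_eq ?_) (Complex.re_le_norm _)
    rw [Complex.ofReal_re, Complex.re_sum, ← Finset.sum_coe_sort s,
      ← Equiv.sum_comp s.equivFin.symm]
    refine Finset.sum_congr rfl fun i _ => ?_
    rw [ContinuousLinearMap.comp_apply, ContinuousLinearMap.adjoint_inner_right,
      ContinuousLinearMap.comp_apply]
    have : X (EuclideanSpace.basisFun (Fin n) ℂ i) = b (s.equivFin.symm i) := hJ i
    rw [this, ← inner_conj_symm, Complex.conj_re]
  rw [Complex.ofReal_re] at e2
  refine e2.trans ?_
  rw [e1, opTrace_add]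
  refine (norm_add_le _ _).trans (add_le_add ?_ ?_)
  · refine h n X _ hX1 ((ContinuousLinearMap.opNorm_comp_le _ _).trans
      (mul_le_one₀ hX1' (norm_nonneg _) (by simpa using hV)))
  · refine (norm_opTrace_le _).trans ?_
    have h1 : ‖X' ∘L (P - star V * T) ∘L X‖ ≤ ε / (n + 1) :=
      (norm_comp_comp_le_of_le_one hX1' hX1 _).trans hTV
    rw [finrank_euclideanSpace_fin]
    calc (n : ℝ) * _ ≤ (n + 1) * (ε / (n + 1)) := by gcongr; linarith
      _ = ε := by field_simp

end traceClass

/-! ### Block operators on finite Hilbert sums -/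

section blocks

theorem norm_sum_sq_of_pairwise_inner_eq_zero {ι H : Type*} [NormedAddCommGroup H]
    [InnerProductSpace ℂ H] (s : Finset ι) {v : ι → H}
    (hv : ∀ i j, i ≠ j → inner ℂ (v i) (v j) = 0) : ‖∑ i ∈ s, v i‖ ^ 2 = ∑ i ∈ s, ‖v i‖ ^ 2 := by
  classical
  induction s using Finset.induction_on with
  | empty => simp
  | insert a s ha ih =>
    rw [Finset.sum_insert ha, Finset.sum_insert ha, ← ih, sq, sq, sq]
    refine norm_add_sq_eq_norm_sq_add_norm_sq_of_inner_eq_zero (𝕜 := ℂ) _ _ ?_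
    rw [inner_sum]
    exact Finset.sum_eq_zero fun i hi => hv _ _ fun h => ha (h ▸ hi)

variable {ι : Type*} [Fintype ι] [DecidableEq ι] {E : ι → Type*} [∀ i, NormedAddCommGroup (E i)]
  [∀ i, InnerProductSpace ℂ (E i)] {H : Type*} [NormedAddCommGroup H] [InnerProductSpace ℂ H]

/-- The inclusion of a summand into a finite Hilbert sum. -/
noncomputable def blockIncl (E : ι → Type*) [∀ i, NormedAddCommGroup (E i)]
    [∀ i, InnerProductSpace ℂ (E i)] (i : ι) : E i →L[ℂ] PiLp 2 E :=
  LinearIsometry.toContinuousLinearMap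
    { toFun := fun x => PiLp.single 2 i x
      map_add' := fun x y => PiLp.single_add 2 i
      map_smul' := fun c x => by
        ext j
        rcases eq_or_ne j i with rfl | h
        · simp
        · simp [h]
      norm_map' := fun x => PiLp.norm_single 2 E i x }

/-- The projection of a finite Hilbert sum onto a summand. -/
noncomputable def blockProj (E : ι → Type*) [∀ i, NormedAddCommGroup (E i)]
    [∀ i, InnerProductSpace ℂ (E i)] (i : ι) : PiLp 2 E →L[ℂ] E i :=
  PiLp.proj 2 E i

theorem blockIncl_apply (i : ι) (x : E i) : blockIncl E i x = PiLp.single 2 i x := rfl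

@[simp] theorem blockProj_apply (i : ι) (x : PiLp 2 E) : blockProj E i x = x i := rfl

@[simp] theorem blockIncl_apply_same (i : ι) (x : E i) : (blockIncl E i x) i = x := by
  simp [blockIncl_apply]

theorem blockIncl_apply_of_ne {i j : ι} (h : j ≠ i) (x : E i) : (blockIncl E i x) j = 0 := by
  simp [blockIncl_apply, h]

theorem sum_blockIncl (x : PiLp 2 E) : ∑ i, blockIncl E i (x i) = x := by
  ext j
  rw [WithLp.ofLp_sum, Finset.sum_apply, Finset.sum_eq_single j]
  · simp
  · intro i _ h
    exact blockIncl_apply_of_ne h.symm _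
  · simp

theorem norm_blockIncl_le (i : ι) : ‖blockIncl E i‖ ≤ 1 :=
  LinearIsometry.norm_toContinuousLinearMap_le _

theorem norm_blockProj_le (i : ι) : ‖blockProj E i‖ ≤ 1 :=
  ContinuousLinearMap.opNorm_le_bound _ zero_le_one fun x => by
    simpa using PiLp.norm_apply_le x i

theorem adjoint_blockIncl [∀ i, CompleteSpace (E i)] (i : ι) :
    ContinuousLinearMap.adjoint (blockIncl E i) = blockProj E i := by
  symm
  rw [ContinuousLinearMap.eq_adjoint_iff]
  intro x y
  rw [PiLp.inner_apply, Finset.sum_eq_single i]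
  · simp
  · intro j _ h
    rw [blockIncl_apply_of_ne h, inner_zero_right]
  · simp

theorem adjoint_blockProj [∀ i, CompleteSpace (E i)] (i : ι) :
    ContinuousLinearMap.adjoint (blockProj E i) = blockIncl E i := by
  rw [← adjoint_blockIncl, ContinuousLinearMap.adjoint_adjoint]

/-- The row operator with entries `T i : E i → H`. -/
noncomputable def blockRow (T : ∀ i, E i →L[ℂ] H) : PiLp 2 E →L[ℂ] H :=
  ∑ i, T i ∘L blockProj E i

theorem blockRow_apply (T : ∀ i, E i →L[ℂ] H) (x : PiLp 2 E) : blockRow T x = ∑ i, T i (x i) := by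
  simp [blockRow]

@[simp] theorem blockRow_comp_blockIncl (T : ∀ i, E i →L[ℂ] H) (i : ι) :
    blockRow T ∘L blockIncl E i = T i := by
  ext x
  rw [ContinuousLinearMap.comp_apply, blockRow_apply, Finset.sum_eq_single i]
  · simp
  · intro j _ h
    rw [blockIncl_apply_of_ne h, map_zero]
  · simp

/-- A row of operators bounded by `c` with mutually orthogonal ranges is bounded by `c`. -/
theorem norm_blockRow_le {T : ∀ i, E i →L[ℂ] H} {c : ℝ} (hc : 0 ≤ c) (hT : ∀ i, ‖T i‖ ≤ c)
    (h : ∀ i j, i ≠ j → ∀ x y, inner ℂ (T i x) (T j y) = 0) : ‖blockRow T‖ ≤ c := by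
  refine ContinuousLinearMap.opNorm_le_bound _ hc fun x => ?_
  refine le_of_sq_le_sq ?_ (by positivity)
  rw [blockRow_apply, norm_sum_sq_of_pairwise_inner_eq_zero _ fun i j hij => h i j hij _ _, mul_pow,
    PiLp.norm_sq_eq_of_L2, Finset.mul_sum]
  refine Finset.sum_le_sum fun i _ => ?_
  rw [← mul_pow]
  exact pow_le_pow_left₀ (norm_nonneg _) (((T i).le_opNorm _).trans
    (mul_le_mul_of_nonneg_right (hT i) (norm_nonneg _))) 2

/-- The block diagonal operator. -/
noncomputable def blockDiag (A : ∀ i, E i →L[ℂ] E i) : PiLp 2 E →L[ℂ] PiLp 2 E :=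
  blockRow fun i => blockIncl E i ∘L A i

@[simp] theorem blockDiag_apply (A : ∀ i, E i →L[ℂ] E i) (x : PiLp 2 E) (i : ι) :
    blockDiag A x i = A i (x i) := by
  rw [blockDiag, blockRow_apply, WithLp.ofLp_sum, Finset.sum_apply, Finset.sum_eq_single i]
  · simp
  · intro j _ h
    exact blockIncl_apply_of_ne h.symm _
  · simp

theorem norm_blockDiag_le {A : ∀ i, E i →L[ℂ] E i} {c : ℝ} (hc : 0 ≤ c) (hA : ∀ i, ‖A i‖ ≤ c) :
    ‖blockDiag A‖ ≤ c := by
  refine norm_blockRow_le hc (fun i => ?_) fun i j hij x y => ?_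
  · exact (ContinuousLinearMap.opNorm_comp_le _ _).trans
      ((mul_le_of_le_one_left (norm_nonneg _) (norm_blockIncl_le i)).trans (hA i))
  · rw [PiLp.inner_apply]
    refine Finset.sum_eq_zero fun k _ => ?_
    rcases eq_or_ne k i with rfl | h
    · rw [ContinuousLinearMap.comp_apply, ContinuousLinearMap.comp_apply,
        blockIncl_apply_of_ne hij, inner_zero_right]
    · rw [ContinuousLinearMap.comp_apply, blockIncl_apply_of_ne h, inner_zero_left]

theorem isSelfAdjoint_blockDiag [∀ i, CompleteSpace (E i)] {A : ∀ i, E i →L[ℂ] E i}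
    (hA : ∀ i, IsSelfAdjoint (A i)) : IsSelfAdjoint (blockDiag A) := by
  rw [ContinuousLinearMap.isSelfAdjoint_iff_isSymmetric]
  intro x y
  rw [PiLp.inner_apply, PiLp.inner_apply]
  refine Finset.sum_congr rfl fun i _ => ?_
  simpa using (hA i).inner_apply (x i) (y i)

/-- The projections onto the summands intertwine a block diagonal operator with its blocks. -/
theorem opFun_blockDiag [∀ i, CompleteSpace (E i)] [∀ i, FiniteDimensional ℂ (E i)] (f : ℝ → ℂ)
    {A : ∀ i, E i →L[ℂ] E i} (hA : ∀ i, IsSelfAdjoint (A i)) :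
    opFun f (blockDiag A) = blockDiag fun i => opFun f (A i) := by
  ext x i
  have h : blockProj E i ∘L blockDiag A = A i ∘L blockProj E i := by
    ext x
    simp
  have h1 := congrArg (fun T => T x)
    (comp_opFun_of_comp_eq f (isSelfAdjoint_blockDiag hA) (hA i) h)
  simpa using h1

theorem opTrace_blockDiag [∀ i, FiniteDimensional ℂ (E i)] (T : PiLp 2 E →L[ℂ] PiLp 2 E) :
    opTrace T = ∑ i, opTrace (blockProj E i ∘L T ∘L blockIncl E i) := by
  have e : T = ∑ i, (T ∘L blockIncl E i) ∘L blockProj E i := by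
    ext1 x
    rw [sum_apply]
    nth_rewrite 1 [← sum_blockIncl x]
    rw [map_sum]
    rfl
  nth_rewrite 1 [e]
  rw [opTrace_sum]
  exact Finset.sum_congr rfl fun i _ => opTrace_comp_comm _ _

theorem TraceNormLE.blockDiag {A : ∀ i, E i →L[ℂ] E i} {M : ι → ℝ}
    (hA : ∀ i, TraceNormLE (A i) (M i)) : TraceNormLE (blockDiag A) (∑ i, M i) := by
  refine TraceNormLE.sum _ fun i _ => ?_
  rw [ContinuousLinearMap.comp_assoc]
  exact (hA i).comp_of_norm_le_one (norm_blockIncl_le i) (norm_blockProj_le i)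

end blocks

/-! ### Unitarily invariant norms and commutator estimates -/

/-- A unitarily invariant norm on operators, given by the relation `le T M` that the norm of `T` is
at most `M`, which makes sense for operators of infinite norm as well. The
field `of_compression` says that the norm is determined by finite-dimensional compressions. The last
two fields compare it with the operator norm on finite-dimensional spaces. -/
structure SymmetricNorm where
  le : ∀ {E : Type u} [NormedAddCommGroup E] [InnerProductSpace ℂ E], (E →L[ℂ] E) → ℝ → Prop
  mono : ∀ {E : Type u} [NormedAddCommGroup E] [InnerProductSpace ℂ E] {T : E →L[ℂ] E} {M N : ℝ},
    le T M → M ≤ N → le T N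
  add : ∀ {E : Type u} [NormedAddCommGroup E] [InnerProductSpace ℂ E] {S T : E →L[ℂ] E} {M N : ℝ},
    le S M → le T N → le (S + T) (M + N)
  comp : ∀ {E F : Type u} [NormedAddCommGroup E] [InnerProductSpace ℂ E] [NormedAddCommGroup F]
    [InnerProductSpace ℂ F] {T : E →L[ℂ] E} {M : ℝ}, le T M →
    ∀ (Y : E →L[ℂ] F) (X : F →L[ℂ] E), le (Y ∘L T ∘L X) (‖Y‖ * ‖X‖ * M)
  adjoint : ∀ {E : Type u} [NormedAddCommGroup E] [InnerProductSpace ℂ E] [CompleteSpace E]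
    {T : E →L[ℂ] E} {M : ℝ}, le T M → le (ContinuousLinearMap.adjoint T) M
  of_forall_pos : ∀ {E : Type u} [NormedAddCommGroup E] [InnerProductSpace ℂ E] {T : E →L[ℂ] E}
    {M : ℝ}, (∀ ε, 0 < ε → le T (M + ε)) → le T M
  of_compression : ∀ {E : Type u} [NormedAddCommGroup E] [InnerProductSpace ℂ E] {T : E →L[ℂ] E}
    {M : ℝ}, 0 ≤ M → (∀ (V : Submodule ℂ E) [FiniteDimensional ℂ V] (Y : E →L[ℂ] V), ‖Y‖ ≤ 1 →
    le (Y ∘L T ∘L V.subtypeL) M) → le T M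
  of_norm : ∀ {E : Type u} [NormedAddCommGroup E] [InnerProductSpace ℂ E] [FiniteDimensional ℂ E]
    (T : E →L[ℂ] E), le T ((Module.finrank ℂ E + 1) * ‖T‖)
  norm_le : ∀ {E : Type u} [NormedAddCommGroup E] [InnerProductSpace ℂ E] [FiniteDimensional ℂ E]
    {T : E →L[ℂ] E} {M : ℝ}, le T M → ‖T‖ ≤ M

namespace SymmetricNorm

/-- The operator norm. -/
def operator : SymmetricNorm.{u} where
  le T M := ‖T‖ ≤ M
  mono := le_trans
  add h h' := (norm_add_le _ _).trans (add_le_add h h')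
  comp := fun {E F _ _ _ _ T M} h Y X => by
    refine (ContinuousLinearMap.opNorm_comp_le _ _).trans ?_
    rw [mul_assoc]
    refine mul_le_mul_of_nonneg_left ?_ (norm_nonneg _)
    rw [mul_comm]
    exact (ContinuousLinearMap.opNorm_comp_le _ _).trans
      (mul_le_mul_of_nonneg_right h (norm_nonneg _))
  adjoint h := by simpa using h
  of_forall_pos h := le_of_forall_pos_le_add h
  of_compression := fun {E _ _ T M} h0 h => by
    refine ContinuousLinearMap.opNorm_le_of_re_inner_le h0 fun x y hx hy => ?_
    -- The number `⟪T x, y⟫` is visible in the compression of `T` to the span of `x` and `y`.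
    let V : Submodule ℂ E := Submodule.span ℂ {x, y}
    have : FiniteDimensional ℂ V := FiniteDimensional.span_of_finite ℂ (Set.toFinite _)
    have hxV : x ∈ V := Submodule.subset_span (by simp)
    have hyV : y ∈ V := Submodule.subset_span (by simp)
    have h1 := h V V.orthogonalProjectionOnto V.orthogonalProjectionOnto_norm_le
    have h2 : inner ℂ (T x) y =
        inner ℂ ((V.orthogonalProjectionOnto ∘L T ∘L V.subtypeL) ⟨x, hxV⟩) (⟨y, hyV⟩ : V) := by
      simp
    rw [h2]
    refine (RCLike.re_le_norm _).trans ((norm_inner_le_norm _ _).trans ?_)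
    have h3 := ContinuousLinearMap.le_of_opNorm_le _ h1 ⟨x, hxV⟩
    have hx' : ‖(⟨x, hxV⟩ : V)‖ = 1 := hx
    have hy' : ‖(⟨y, hyV⟩ : V)‖ = 1 := hy
    rw [hy', mul_one]
    rwa [hx', mul_one] at h3
  of_norm T := le_mul_of_one_le_left (norm_nonneg _) (by simp)
  norm_le h := h

/-- The trace norm. -/
def trace : SymmetricNorm.{u} where
  le T M := TraceNormLE T M
  mono := TraceNormLE.mono
  add := TraceNormLE.add
  comp h := h.comp
  adjoint := TraceNormLE.adjoint
  of_forall_pos h := TraceNormLE.of_forall_pos (c := 1) zero_lt_one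
    fun ε h0 _ => by simpa using h ε h0
  of_compression := fun {E _ _ T M} h0 h n X Y hX hY => by
    let V : Submodule ℂ E := LinearMap.range (X : EuclideanSpace ℂ (Fin n) →ₗ[ℂ] E)
    have : FiniteDimensional ℂ V := inferInstance
    let X₀ : EuclideanSpace ℂ (Fin n) →L[ℂ] V := X.codRestrict V fun x => ⟨x, rfl⟩
    have hX₀ : ‖X₀‖ ≤ 1 := ContinuousLinearMap.opNorm_le_bound _ zero_le_one fun x =>
      X.le_of_opNorm_le hX x
    have h1 := h V (X₀ ∘L Y) ((ContinuousLinearMap.opNorm_comp_le _ _).trans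
      (mul_le_one₀ hX₀ (norm_nonneg _) hY))
    have h2 := h1.norm_opTrace_comp_le (ContinuousLinearMap.id ℂ V)
    have e : (Y ∘L T ∘L X) = (Y ∘L T ∘L V.subtypeL) ∘L X₀ := rfl
    rw [e, opTrace_comp_comm]
    exact h2.trans (mul_le_of_le_one_right h0 ContinuousLinearMap.norm_id_le)
  of_norm T := (TraceNormLE.of_finiteDimensional T).mono
    (mul_le_mul_of_nonneg_right (by linarith) (norm_nonneg _))
  norm_le h := h.norm_le

variable (N : SymmetricNorm.{u})

theorem comp_le {E F : Type u} [NormedAddCommGroup E] [InnerProductSpace ℂ E]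
    [NormedAddCommGroup F] [InnerProductSpace ℂ F] {T : E →L[ℂ] E} {M a b : ℝ} (hM : 0 ≤ M)
    (h : N.le T M) {Y : E →L[ℂ] F} {X : F →L[ℂ] E} (hY : ‖Y‖ ≤ a) (hX : ‖X‖ ≤ b) :
    N.le (Y ∘L T ∘L X) (a * b * M) :=
  N.mono (N.comp h Y X) (mul_le_mul_of_nonneg_right
    (mul_le_mul hY hX (norm_nonneg _) ((norm_nonneg _).trans hY)) hM)

theorem comp_le_one {E F : Type u} [NormedAddCommGroup E] [InnerProductSpace ℂ E]
    [NormedAddCommGroup F] [InnerProductSpace ℂ F] {T : E →L[ℂ] E} {M : ℝ} (hM : 0 ≤ M)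
    (h : N.le T M) {Y : E →L[ℂ] F} {X : F →L[ℂ] E} (hY : ‖Y‖ ≤ 1) (hX : ‖X‖ ≤ 1) :
    N.le (Y ∘L T ∘L X) M := by
  simpa using N.comp_le hM h hY hX

theorem neg {E : Type u} [NormedAddCommGroup E] [InnerProductSpace ℂ E] {T : E →L[ℂ] E} {M : ℝ}
    (hM : 0 ≤ M) (h : N.le T M) : N.le (-T) M := by
  have := N.comp_le_one hM h (Y := -ContinuousLinearMap.id ℂ E) (X := ContinuousLinearMap.id ℂ E)
    (by simpa using ContinuousLinearMap.norm_id_le) ContinuousLinearMap.norm_id_le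
  simpa using this

/-- The function `f` is Lipschitz with constant `C` with respect to the norm `N` on the self-adjoint
operators of operator norm at most `δ` on finite-dimensional spaces. -/
def LipschitzFor (f : ℝ → ℂ) (δ C : ℝ) : Prop :=
  ∀ (E : Type u) [NormedAddCommGroup E] [InnerProductSpace ℂ E] [CompleteSpace E]
    [FiniteDimensional ℂ E] (A B : E →L[ℂ] E), IsSelfAdjoint A → IsSelfAdjoint B →
    ‖A‖ ≤ δ → ‖B‖ ≤ δ → ∀ M, 0 < M → N.le (A - B) M → N.le (opFun f A - opFun f B) (C * M)

variable {N}
variable {f : ℝ → ℂ} {δ C : ℝ} {E : Type u} [NormedAddCommGroup E] [InnerProductSpace ℂ E]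
  [CompleteSpace E] [FiniteDimensional ℂ E]

/-- The commutator of `A` with a unitary operator `U` is `(A - U A U*) U`, and likewise for
`f(A)`. -/
theorem LipschitzFor.commutator_unitary (hf : N.LipschitzFor f δ C) (hC : 0 ≤ C) {A U : E →L[ℂ] E}
    (hA : IsSelfAdjoint A) (hδ : ‖A‖ ≤ δ) (hU : star U * U = 1) (hU' : U * star U = 1) {M : ℝ}
    (hM : 0 < M) (h : N.le (A * U - U * A) M) :
    N.le (opFun f A * U - U * opFun f A) (C * M) := by
  have hUn : ‖U‖ ≤ 1 := by
    have h1 : ‖U‖ * ‖U‖ ≤ 1 := by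
      rw [← CStarRing.norm_star_mul_self, hU]
      exact ContinuousLinearMap.norm_id_le
    nlinarith [norm_nonneg U]
  have hUn' : ‖star U‖ ≤ 1 := by rwa [norm_star]
  have h1n : ‖(1 : E →L[ℂ] E)‖ ≤ 1 := ContinuousLinearMap.norm_id_le
  set B := U * A * star U with hB
  have hBsa : IsSelfAdjoint B := by
    rw [IsSelfAdjoint, hB, star_mul, star_mul, star_star, hA.star_eq, mul_assoc]
  have hBδ : ‖B‖ ≤ δ := by
    refine le_trans (norm_mul_le _ _) ((mul_le_of_le_one_right (norm_nonneg _) hUn').trans ?_)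
    exact (norm_mul_le _ _).trans ((mul_le_of_le_one_left (norm_nonneg _) hUn).trans hδ)
  have hUB : U * A = B * U := by rw [hB, mul_assoc, hU, mul_one]
  have hUf : U * opFun f A = opFun f B * U := comp_opFun_of_comp_eq f hA hBsa hUB
  have h1 : N.le (A - B) M := by
    have := N.comp_le_one hM.le h h1n hUn'
    have e : (1 : E →L[ℂ] E) ∘L (A * U - U * A) ∘L star U = A - B := by
      change 1 * ((A * U - U * A) * star U) = A - B
      rw [one_mul, sub_mul, mul_assoc, hU', mul_one]
    rwa [e] at this
  have h2 := N.comp_le_one (by positivity) (hf E A B hA hBsa hδ hBδ M hM h1) h1n hUn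
  have e : (1 : E →L[ℂ] E) ∘L (opFun f A - opFun f B) ∘L U = opFun f A * U - U * opFun f A := by
    change 1 * ((opFun f A - opFun f B) * U) = _
    rw [one_mul, sub_mul, hUf]
  rwa [e] at h2

/-- Passing from unitary to self-adjoint operators by a Cayley transform: if
`U = (1 + i s R) (1 - i s R)⁻¹` then `[A, U] = 2 i s K [A, R] K` with `K = (1 - i s R)⁻¹`. -/
theorem LipschitzFor.commutator_selfAdjoint (hf : N.LipschitzFor f δ C) (hC : 0 ≤ C)
    {A R : E →L[ℂ] E} (hA : IsSelfAdjoint A) (hδ : ‖A‖ ≤ δ) (hR : IsSelfAdjoint R) {M : ℝ}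
    (hM : 0 < M) (h : N.le (A * R - R * A) M) :
    N.le (opFun f A * R - R * opFun f A) (4 * C * M) := by
  have h1n : ‖(1 : E →L[ℂ] E)‖ ≤ 1 := ContinuousLinearMap.norm_id_le
  -- With this `s` the operator `S = i s R` has norm at most `1 / 4`, so that `1 - S` and its
  -- inverse `K` have norms close enough to `1` to lose no more than a factor `4`.
  set s : ℝ := 1 / (4 * (‖R‖ + 1)) with hs
  have hs0 : 0 < s := by positivity
  set c : ℂ := Complex.I * s with hc
  have hcn : ‖c‖ = s := by simp [hc, abs_of_pos hs0]
  have hc0 : c ≠ 0 := by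
    rw [← norm_pos_iff, hcn]; exact hs0
  set S := c • R with hS
  have hSn : ‖S‖ ≤ 1 / 4 := by
    rw [hS, norm_smul, hcn, hs, div_mul_eq_mul_div, one_mul, div_le_div_iff₀ (by positivity)
      (by norm_num)]
    linarith
  have hSs : star S = -S := by
    rw [hS, star_smul, hR.star_eq, hc]
    simp
  set Zu := Units.oneSub S (hSn.trans_lt (by norm_num)) with hZu
  set K : E →L[ℂ] E := ↑Zu⁻¹ with hK
  have hZ : (Zu : E →L[ℂ] E) = 1 - S := rfl
  have hKZ : K * (1 - S) = 1 := by rw [← hZ, hK]; exact Zu.inv_mul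
  have hZK : (1 - S) * K = 1 := by rw [← hZ, hK]; exact Zu.mul_inv
  have hKn : ‖K‖ ≤ 4 / 3 := by
    have e : K = 1 + K * S := by rw [← hKZ]; noncomm_ring
    have h1 : ‖K‖ ≤ 1 + ‖K‖ * (1 / 4) := by
      calc ‖K‖ = ‖1 + K * S‖ := by rw [← e]
        _ ≤ ‖(1 : E →L[ℂ] E)‖ + ‖K * S‖ := norm_add_le _ _
        _ ≤ 1 + ‖K‖ * (1 / 4) := add_le_add h1n ((norm_mul_le _ _).trans
            (mul_le_mul_of_nonneg_left hSn (norm_nonneg _)))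
    linarith
  have hZn : ‖1 - S‖ ≤ 5 / 4 := by
    refine (norm_sub_le _ _).trans ?_
    linarith
  have hKs1 : star K * (1 + S) = 1 := by
    have := congrArg star hZK
    simpa [star_mul, hSs] using this
  have hKs2 : (1 + S) * star K = 1 := by
    have := congrArg star hKZ
    simpa [star_mul, hSs] using this
  have hcomm : (1 + S) * K = K * (1 + S) := by
    have e1 : (1 + S) * K = 2 * K - (1 - S) * K := by noncomm_ring
    have e2 : K * (1 + S) = 2 * K - K * (1 - S) := by noncomm_ring
    rw [e1, e2, hKZ, hZK]
  -- The Cayley transform of `R`.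
  obtain ⟨U, hU⟩ : ∃ U, U = (1 + S) * K := ⟨_, rfl⟩
  rw [← hU] at hcomm
  have hUs : star U = star K * (1 - S) := by
    rw [hU, star_mul, star_add, star_one, hSs, ← sub_eq_add_neg]
  have hUU : star U * U = 1 := by
    rw [hUs, hcomm, mul_assoc, ← mul_assoc (1 - S), hZK, one_mul, hKs1]
  have hUU' : U * star U = 1 := by
    rw [hUs, hcomm, mul_assoc, ← mul_assoc (1 + S), hKs2, one_mul, hKZ]
  have key : ∀ X : E →L[ℂ] E, X * U - U * X = ((2 * c) • K) * ((X * R - R * X) * K) := by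
    intro X
    have hU2 : U = 2 * K - 1 := by
      have e1 : (1 + S) * K = 2 * K - (1 - S) * K := by noncomm_ring
      rw [hU, e1, hZK]
    have e2 : X * K - K * X = K * ((1 - S) * X - X * (1 - S)) * K := by
      rw [mul_sub, sub_mul, ← mul_assoc K, hKZ, one_mul, mul_assoc K (X * _), mul_assoc X, hZK,
        mul_one]
    have e3 : (1 - S) * X - X * (1 - S) = c • (X * R - R * X) := by
      rw [hS, smul_sub, ← mul_smul_comm, ← smul_mul_assoc]; noncomm_ring
    have e4 : X * U - U * X = (2 : ℂ) • (X * K - K * X) := by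
      rw [hU2, two_smul]; noncomm_ring
    rw [e4, e2, e3, mul_smul_comm, smul_mul_assoc, smul_smul, smul_mul_assoc, mul_assoc]
  have h1 : N.le (A * U - U * A) (2 * s * (4 / 3) * (4 / 3) * M) := by
    rw [key A]
    refine N.comp_le hM.le h ?_ hKn
    rw [norm_smul, norm_mul, hcn, RCLike.norm_ofNat]
    exact mul_le_mul_of_nonneg_left hKn (by positivity)
  have h2 := hf.commutator_unitary hC hA hδ hUU hUU' (by positivity) h1
  have e : opFun f A * R - R * opFun f A =
      ((2 * c)⁻¹ • (1 - S)) ∘L (opFun f A * U - U * opFun f A) ∘L (1 - S) := by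
    change _ = ((2 * c)⁻¹ • (1 - S)) * ((opFun f A * U - U * opFun f A) * (1 - S))
    rw [key, mul_assoc, mul_assoc, hKZ, mul_one, ← mul_assoc, smul_mul_smul_comm,
      inv_mul_cancel₀ (by simpa using hc0), one_smul, hZK, one_mul]
  rw [e]
  refine N.mono (N.comp_le (a := (2 * s)⁻¹ * (5 / 4)) (b := 5 / 4) (by positivity) h2 ?_ hZn) ?_
  · rw [norm_smul, norm_inv, norm_mul, hcn, RCLike.norm_ofNat]
    exact mul_le_mul_of_nonneg_left hZn (by positivity)
  · have : (2 * s)⁻¹ * (5 / 4) * (5 / 4) * (C * (2 * s * (4 / 3) * (4 / 3) * M)) =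
        25 / 9 * (C * M) := by
      field_simp
      ring
    rw [this]
    nlinarith [mul_nonneg hC hM.le]

/-- The estimate for quasicommutators, from that for commutators with `2 × 2` block operators. -/
theorem LipschitzFor.quasicommutator (hf : N.LipschitzFor f δ C) (hC : 0 ≤ C) (hδ0 : 0 ≤ δ)
    {A B : E →L[ℂ] E} (hA : IsSelfAdjoint A) (hB : IsSelfAdjoint B) (hAδ : ‖A‖ ≤ δ) (hBδ : ‖B‖ ≤ δ)
    {X : E →L[ℂ] E} {M : ℝ} (hM : 0 < M) (h : N.le (A * X - X * B) M) :
    N.le (opFun f A * X - X * opFun f B) (8 * C * M) := by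
  let D : Fin 2 → Type u := fun _ => E
  let A' : ∀ i : Fin 2, D i →L[ℂ] D i := ![A, B]
  have hA' : ∀ i, IsSelfAdjoint (A' i) := Fin.forall_fin_two.2 ⟨hA, hB⟩
  have hA'δ : ∀ i, ‖A' i‖ ≤ δ := Fin.forall_fin_two.2 ⟨hAδ, hBδ⟩
  have i0 : ContinuousLinearMap.adjoint (blockIncl D 0) = blockProj D 0 := adjoint_blockIncl 0
  have i1 : ContinuousLinearMap.adjoint (blockIncl D 1) = blockProj D 1 := adjoint_blockIncl 1
  have p0 : ContinuousLinearMap.adjoint (blockProj D 0) = blockIncl D 0 := adjoint_blockProj 0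
  have p1 : ContinuousLinearMap.adjoint (blockProj D 1) = blockIncl D 1 := adjoint_blockProj 1
  -- `R` has the off-diagonal blocks `X` and `X*`; its commutator with `diag (A, B)` has the
  -- off-diagonal blocks `Z = A X - X B` and `-Z*`.
  set R : PiLp 2 D →L[ℂ] PiLp 2 D := blockIncl D 0 ∘L X ∘L blockProj D 1 +
    blockIncl D 1 ∘L ContinuousLinearMap.adjoint X ∘L blockProj D 0 with hR
  have hRsa : IsSelfAdjoint R := by
    rw [IsSelfAdjoint, ContinuousLinearMap.star_eq_adjoint, hR]
    simp only [map_add, ContinuousLinearMap.adjoint_comp, ContinuousLinearMap.adjoint_adjoint,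
      i0, i1, p0, p1, ContinuousLinearMap.comp_assoc]
    rw [add_comm]
  set Z := A * X - X * B with hZ
  have hW : N.le (blockIncl D 0 ∘L Z ∘L blockProj D 1) M :=
    N.comp_le_one hM.le h (norm_blockIncl_le 0) (norm_blockProj_le 1)
  have h10 : (1 : Fin 2) ≠ 0 := by decide
  have e : blockDiag A' * R - R * blockDiag A' = blockIncl D 0 ∘L Z ∘L blockProj D 1 +
      -ContinuousLinearMap.adjoint (blockIncl D 0 ∘L Z ∘L blockProj D 1) := by
    have hZs : ContinuousLinearMap.adjoint Z = ContinuousLinearMap.adjoint X * A -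
        B * ContinuousLinearMap.adjoint X := by
      rw [hZ, map_sub]
      change star (A * X) - star (X * B) = star X * A - B * star X
      rw [star_mul, star_mul, hA.star_eq, hB.star_eq]
    simp only [ContinuousLinearMap.adjoint_comp, i0, p1]
    rw [hZs, hZ]
    ext x i
    fin_cases i
    · simp [hR, A', blockIncl_apply_of_ne h10.symm]
    · simp [hR, A', blockIncl_apply_of_ne h10]
  have h1 : N.le (blockDiag A' * R - R * blockDiag A') (M + M) := by
    rw [e]
    exact N.add hW (N.neg hM.le (N.adjoint hW))
  have h2 := hf.commutator_selfAdjoint hC (isSelfAdjoint_blockDiag hA')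
    (norm_blockDiag_le hδ0 hA'δ) hRsa (by positivity) h1
  have h3 := N.comp_le_one (by positivity) h2 (norm_blockProj_le (E := D) 0)
    (norm_blockIncl_le (E := D) 1)
  rw [opFun_blockDiag f hA'] at h3
  convert h3 using 1
  · ext x
    simp [hR, A', blockIncl_apply_of_ne h10.symm]
  · ring

end SymmetricNorm

/-! ### Duality of Lipschitz estimates -/

section sylvester

variable {E : Type*} [NormedAddCommGroup E] [InnerProductSpace ℂ E]
  [CompleteSpace E] [FiniteDimensional ℂ E]

/-- The eigenvectors of a self-adjoint operator on a finite-dimensional space span it. -/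
theorem eq_zero_of_forall_eigenvector {F : Type*} [NormedAddCommGroup F] [NormedSpace ℂ F]
    {A : E →L[ℂ] E} (hA : IsSelfAdjoint A) {T : E →L[ℂ] F}
    (h : ∀ (t : ℝ) (x : E), A x = (t : ℂ) • x → T x = 0) : T = 0 := by
  have hs : (A : E →ₗ[ℂ] E).IsSymmetric := hA.isSymmetric
  have h1 : (T : E →ₗ[ℂ] F) = 0 := by
    refine (hs.eigenvectorBasis rfl).toBasis.ext fun i => ?_
    rw [OrthonormalBasis.coe_toBasis]
    exact h (hs.eigenvalues rfl i) _ (hs.apply_eigenvectorBasis rfl i)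
  ext x
  exact congrArg (fun S => S x) h1

/-- The Sylvester equation `X A - B X = W` is solvable if `A` and `B` have no common eigenvalue. -/
theorem exists_mul_sub_mul_eq {A B : E →L[ℂ] E} (hA : IsSelfAdjoint A)
    (h : ∀ z ∈ spectrum ℂ A, z ∉ spectrum ℂ B) (W : E →L[ℂ] E) :
    ∃ X : E →L[ℂ] E, X * A - B * X = W := by
  let L : (E →L[ℂ] E) →ₗ[ℂ] (E →L[ℂ] E) :=
    LinearMap.mulRight ℂ A - LinearMap.mulLeft ℂ B
  have hL : ∀ X, L X = X * A - B * X := fun X => by simp [L]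
  have hinj : Function.Injective L := by
    rw [← LinearMap.ker_eq_bot, LinearMap.ker_eq_bot']
    intro X hX
    rw [hL, sub_eq_zero] at hX
    refine eq_zero_of_forall_eigenvector hA fun t x hx => ?_
    -- If `X A = B X` then `X` maps eigenvectors of `A` to eigenvectors of `B`, hence to `0`.
    have h1 : B (X x) = (t : ℂ) • X x := by
      rw [← map_smul, ← hx]
      exact (congrArg (fun S : E →L[ℂ] E => S x) hX).symm
    by_contra hne
    have hx0 : x ≠ 0 := by
      rintro rfl
      simp at hne
    exact h _ (mem_spectrum_of_apply_eq_smul hx hx0) (mem_spectrum_of_apply_eq_smul h1 hne)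
  obtain ⟨X, hX⟩ := (LinearMap.injective_iff_surjective.1 hinj) W
  exact ⟨X, by rw [← hL, hX]⟩

theorem opFun_mul_comm (f : ℝ → ℂ) {A : E →L[ℂ] E} (hA : IsSelfAdjoint A) :
    opFun f A * A = A * opFun f A :=
  (comp_opFun_of_comp_eq f hA hA (J := A) rfl).symm

theorem opTrace_mul_comm (S T : E →L[ℂ] E) : opTrace (S * T) = opTrace (T * S) :=
  opTrace_comp_comm S T

/-- The identity by which divided differences act as the same Schur multiplier on both sides of the
trace pairing. -/
theorem opTrace_sub_mul_sub {A B A' B' : E →L[ℂ] E} (hA : A' * A = A * A') (hB : B' * B = B * B')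
    (X : E →L[ℂ] E) :
    opTrace ((A' - B') * (X * A - B * X)) = opTrace ((A - B) * (X * A' - B' * X)) := by
  have e1 : opTrace (A' * X * A) = opTrace (A * A' * X) := by
    rw [opTrace_mul_comm, mul_assoc]
  have e2 : opTrace (A * X * A') = opTrace (A * A' * X) := by
    rw [opTrace_mul_comm, ← mul_assoc, hA]
  have e3 : opTrace (A' * B * X) = opTrace (B * X * A') := by
    rw [mul_assoc, opTrace_mul_comm]
  have e4 : opTrace (B' * X * A) = opTrace (A * B' * X) := by
    rw [opTrace_mul_comm, mul_assoc]
  have h1 : (A' - B') * (X * A - B * X) = A' * X * A - A' * B * X - B' * X * A + B' * B * X := by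
    noncomm_ring
  have h2 : (A - B) * (X * A' - B' * X) = A * X * A' - A * B' * X - B * X * A' + B * B' * X := by
    noncomm_ring
  rw [h1, h2]
  simp only [opTrace_add, opTrace_sub]
  rw [e1, e2, e3, e4, hB]
  ring

end sylvester

namespace SymmetricNorm

/-- The norms `N` and `N'` are dual to each other under the trace pairing. -/
structure IsDual (N N' : SymmetricNorm.{u}) : Prop where
  norm_opTrace_le : ∀ {E : Type u} [NormedAddCommGroup E] [InnerProductSpace ℂ E]
    [FiniteDimensional ℂ E] {T W : E →L[ℂ] E} {M a : ℝ}, N'.le T M → N.le W a →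
    ‖opTrace (T ∘L W)‖ ≤ M * a
  le_of_forall : ∀ {E : Type u} [NormedAddCommGroup E] [InnerProductSpace ℂ E]
    [FiniteDimensional ℂ E] {T : E →L[ℂ] E} {M : ℝ}, 0 ≤ M →
    (∀ W, N.le W 1 → ‖opTrace (T ∘L W)‖ ≤ M) → N'.le T M

theorem isDual_operator_trace : IsDual operator.{u} trace.{u} where
  norm_opTrace_le h hW := (TraceNormLE.norm_opTrace_comp_le h _).trans
    (mul_le_mul_of_nonneg_left hW (TraceNormLE.nonneg h))
  le_of_forall _ h := TraceNormLE.of_forall_opTrace h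

theorem isDual_trace_operator : IsDual trace.{u} operator.{u} where
  norm_opTrace_le {E _ _ _ T W M a} h hW := by
    rw [opTrace_comp_comm, mul_comm]
    exact (TraceNormLE.norm_opTrace_comp_le hW _).trans
      (mul_le_mul_of_nonneg_left h (TraceNormLE.nonneg hW))
  le_of_forall {E _ _ _ T M} h0 h := by
    refine ContinuousLinearMap.opNorm_le_of_re_inner_le h0 fun x y hx hy => ?_
    have h1 := h (InnerProductSpace.rankOne ℂ x y)
      ((TraceNormLE.rankOne x y).mono (by rw [hx, hy, one_mul]))
    rw [opTrace_rankOne_comp] at h1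
    rw [← inner_conj_symm]
    refine (RCLike.re_le_norm _).trans ?_
    rwa [RCLike.norm_conj]

variable {N N' : SymmetricNorm.{u}} {f : ℝ → ℂ} {δ C : ℝ} {E : Type u} [NormedAddCommGroup E]
  [InnerProductSpace ℂ E] [CompleteSpace E] [FiniteDimensional ℂ E]

/-- Duality for operators without common eigenvalues: every `W` is `X A - B X` for some `X`, and the
trace identity moves `f` from `A - B` to the quasicommutator. -/
theorem LipschitzFor.dual_of_disjoint (hf : N.LipschitzFor f δ C) (hN : IsDual N N') (hC : 0 ≤ C)
    (hδ0 : 0 ≤ δ) {A B : E →L[ℂ] E} (hA : IsSelfAdjoint A) (hB : IsSelfAdjoint B) (hAδ : ‖A‖ ≤ δ)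
    (hBδ : ‖B‖ ≤ δ) (hd : ∀ z ∈ spectrum ℂ A, z ∉ spectrum ℂ B) {M : ℝ} (hM : 0 ≤ M)
    (h : N'.le (A - B) M) : N'.le (opFun f A - opFun f B) (8 * C * M) := by
  refine hN.le_of_forall (by positivity) fun W hW => ?_
  obtain ⟨X, hX⟩ := exists_mul_sub_mul_eq hA hd W
  have h1 : N.le (B * X - X * A) 1 := by
    rw [← neg_sub, hX]
    exact N.neg zero_le_one hW
  have h2 := N.neg (by positivity) (hf.quasicommutator hC hδ0 hB hA hBδ hAδ one_pos h1)
  rw [neg_sub, mul_one] at h2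
  have h3 := hN.norm_opTrace_le h h2
  rw [mul_comm M] at h3
  refine le_of_eq_of_le ?_ h3
  rw [← hX]
  exact congrArg norm (opTrace_sub_mul_sub (opFun_mul_comm f hA) (opFun_mul_comm f hB) X)

/-- A function which is Lipschitz for a unitarily invariant norm is Lipschitz for the dual norm.
The spectra are made disjoint by adding a small multiple of the identity to `B`. -/
theorem LipschitzFor.dual (hf : N.LipschitzFor f δ C) (hN : IsDual N N') (hC : 0 ≤ C)
    (hδ0 : 0 < δ) : N'.LipschitzFor f (δ / 2) (8 * C) := by
  intro E _ _ _ _ A B hA hB hAδ hBδ M hM h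
  set d : ℝ := Module.finrank ℂ E + 1 with hd
  have hd0 : 0 < d := by positivity
  refine N'.of_forall_pos fun η hη => ?_
  -- `c * ε` will bound the error caused by replacing `B` by `B + ε`: `d` compares the norms
  -- with the operator norm, and `f(B + ε) - f(B)` is estimated by the hypothesis itself.
  set c : ℝ := 8 * C * d + d * (C * d) with hc
  have hc0 : 0 ≤ c := by positivity
  -- The finitely many shifts for which `A` and `B + ε` have a common eigenvalue.
  have hbad : ((fun p : ℂ × ℂ => p.1.re - p.2.re) '' (spectrum ℂ A ×ˢ spectrum ℂ B)).Finite :=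
    ((finite_spectrum_of_finiteDimensional A).prod (finite_spectrum_of_finiteDimensional B)).image _
  have hpos : 0 < min (δ / 2) (η / (c + 1)) := by positivity
  obtain ⟨ε, ⟨hε0, hε1⟩, hεbad⟩ := ((Set.Ioo_infinite hpos).sdiff hbad).nonempty
  have hεδ : ε ≤ δ / 2 := hε1.le.trans (min_le_left _ _)
  have hεη : c * ε ≤ η := by
    have h1 : ε ≤ η / (c + 1) := hε1.le.trans (min_le_right _ _)
    rw [le_div_iff₀ (by positivity)] at h1
    linarith
  set I : E →L[ℂ] E := (ε : ℂ) • 1 with hI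
  have hIn : ‖I‖ ≤ ε := by
    rw [hI, norm_smul, Complex.norm_real, Real.norm_of_nonneg hε0.le]
    exact mul_le_of_le_one_right hε0.le ContinuousLinearMap.norm_id_le
  set B' := B + I with hB'
  have hIsa : IsSelfAdjoint I := by
    rw [IsSelfAdjoint, hI, star_smul, star_one]
    simp
  have hB'sa : IsSelfAdjoint B' := hB.add hIsa
  have hB'δ : ‖B'‖ ≤ δ := (norm_add_le _ _).trans (by linarith)
  have hdisj : ∀ z ∈ spectrum ℂ A, z ∉ spectrum ℂ B' := by
    intro z hz hz'
    have hzB : z - ε ∈ spectrum ℂ B := by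
      rw [spectrum.mem_iff] at hz' ⊢
      convert hz' using 2
      rw [hB', hI, map_sub, Algebra.algebraMap_eq_smul_one (ε : ℂ)]
      abel
    exact hεbad ⟨(z, z - ε), ⟨hz, hzB⟩, by simp⟩
  have hIN : ∀ N : SymmetricNorm.{u}, N.le I (d * ε) := fun N =>
    N.mono (N.of_norm I) (mul_le_mul_of_nonneg_left hIn hd0.le)
  have h1 : N'.le (A - B') (M + d * ε) := by
    have e : A - B' = A - B + -I := by rw [hB']; abel
    rw [e]
    exact N'.add h (N'.neg (by positivity) (hIN N'))
  have h2 := hf.dual_of_disjoint hN hC hδ0.le hA hB'sa (hAδ.trans (by linarith)) hB'δ hdisj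
    (by positivity) h1
  have h3 := N.norm_le (hf E B' B hB'sa hB hB'δ (hBδ.trans (by linarith)) (d * ε) (by positivity)
    (by rw [hB', add_sub_cancel_left]; exact hIN N))
  have h4 := N'.mono (N'.of_norm _) (mul_le_mul_of_nonneg_left h3 hd0.le)
  have h5 := N'.add h2 h4
  rw [sub_add_sub_cancel] at h5
  refine N'.mono h5 ?_
  have : 8 * C * (M + d * ε) + d * (C * (d * ε)) = 8 * C * M + c * ε := by rw [hc]; ring
  linarith

end SymmetricNorm

section transport

/-- The operator norm Lipschitz property does not depend on the universe of the spaces. -/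
theorem SymmetricNorm.LipschitzFor.transport {f : ℝ → ℂ} {δ C : ℝ} (hC : 0 ≤ C)
    (hf : ∀ n : ℕ, ∀ A B : EuclideanSpace ℂ (ULift.{v} (Fin n)) →L[ℂ]
      EuclideanSpace ℂ (ULift.{v} (Fin n)), IsSelfAdjoint A → IsSelfAdjoint B → ‖A‖ ≤ δ → ‖B‖ ≤ δ →
      ‖opFun f A - opFun f B‖ ≤ C * ‖A - B‖) : operator.{u}.LipschitzFor f δ C := by
  intro E _ _ _ _ A B hA hB hAδ hBδ M hM h
  let b := (stdOrthonormalBasis ℂ E).reindex (Equiv.ulift.{v}.symm)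
  let J : E →L[ℂ] EuclideanSpace ℂ (ULift.{v} (Fin (Module.finrank ℂ E))) :=
    b.repr.toLinearIsometry.toContinuousLinearMap
  let J' := ContinuousLinearMap.adjoint J
  have hJ : ‖J‖ ≤ 1 := LinearIsometry.norm_toContinuousLinearMap_le _
  have hJ' : ‖J'‖ ≤ 1 := by simpa [J'] using hJ
  have hJJ : J' ∘L J = ContinuousLinearMap.id ℂ E := by
    exact (ContinuousLinearMap.norm_map_iff_adjoint_comp_self J).1 fun x => b.repr.norm_map x
  have hconj : ∀ T : E →L[ℂ] E, ‖J ∘L T ∘L J'‖ ≤ ‖T‖ := norm_comp_comp_le_of_le_one hJ hJ'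
  have hsa : ∀ T : E →L[ℂ] E, IsSelfAdjoint T → IsSelfAdjoint (J ∘L T ∘L J') := by
    intro T hT
    rw [IsSelfAdjoint, ContinuousLinearMap.star_eq_adjoint]
    have hT' : ContinuousLinearMap.adjoint T = T := hT
    simp only [J', ContinuousLinearMap.adjoint_comp, ContinuousLinearMap.adjoint_adjoint, hT',
      ContinuousLinearMap.comp_assoc]
  have hint : ∀ T : E →L[ℂ] E, J ∘L T = (J ∘L T ∘L J') ∘L J := by
    intro T
    rw [ContinuousLinearMap.comp_assoc, ContinuousLinearMap.comp_assoc, hJJ]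
    rfl
  have hop : ∀ T : E →L[ℂ] E, IsSelfAdjoint T →
      opFun f T = J' ∘L opFun f (J ∘L T ∘L J') ∘L J := by
    intro T hT
    rw [← comp_opFun_of_comp_eq f hT (hsa T hT) (hint T), ← ContinuousLinearMap.comp_assoc, hJJ]
    rfl
  -- Unitary equivalence moves the estimate from the coordinate space back to `E`.
  have e : opFun f A - opFun f B =
      J' ∘L (opFun f (J ∘L A ∘L J') - opFun f (J ∘L B ∘L J')) ∘L J := by
    rw [hop A hA, hop B hB, ContinuousLinearMap.sub_comp, ContinuousLinearMap.comp_sub]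
  have e2 : J ∘L A ∘L J' - J ∘L B ∘L J' = J ∘L (A - B) ∘L J' := by
    rw [ContinuousLinearMap.sub_comp, ContinuousLinearMap.comp_sub]
  have h1 := hf _ _ _ (hsa A hA) (hsa B hB) ((hconj A).trans hAδ) ((hconj B).trans hBδ)
  change ‖opFun f A - opFun f B‖ ≤ C * M
  rw [e]
  refine (norm_comp_comp_le_of_le_one hJ' hJ _).trans (h1.trans ?_)
  rw [e2]
  exact mul_le_mul_of_nonneg_left ((hconj _).trans h) hC

end transport

/-! ### From finite-dimensional spaces to Hilbert spaces -/

section compression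

variable {H : Type u} [NormedAddCommGroup H] [InnerProductSpace ℂ H] [CompleteSpace H]

/-- The compression of an operator to a finite-dimensional subspace. -/
noncomputable def compression (V : Submodule ℂ H) [FiniteDimensional ℂ V] (A : H →L[ℂ] H) :
    V →L[ℂ] V :=
  V.orthogonalProjectionOnto ∘L A ∘L V.subtypeL

variable {V : Submodule ℂ H} [FiniteDimensional ℂ V] {A B : H →L[ℂ] H}

theorem compression_apply (A : H →L[ℂ] H) (x : V) :
    compression V A x = V.orthogonalProjectionOnto (A x) := rfl

theorem norm_subtypeL_le_one (V : Submodule ℂ H) : ‖V.subtypeL‖ ≤ 1 :=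
  V.subtypeₗᵢ.norm_toContinuousLinearMap_le

theorem norm_compression_le (A : H →L[ℂ] H) : ‖compression V A‖ ≤ ‖A‖ := by
  exact norm_comp_comp_le_of_le_one V.orthogonalProjectionOnto_norm_le (norm_subtypeL_le_one V) A

theorem compression_sub (A B : H →L[ℂ] H) :
    compression V (A - B) = compression V A - compression V B := by
  ext x
  simp [compression_apply]

theorem isSelfAdjoint_compression [CompleteSpace V] (hA : IsSelfAdjoint A) :
    IsSelfAdjoint (compression V A) := by
  rw [ContinuousLinearMap.isSelfAdjoint_iff_isSymmetric]
  intro x y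
  change inner ℂ (V.orthogonalProjectionOnto (A x)) y = inner ℂ x (V.orthogonalProjectionOnto (A y))
  rw [Submodule.inner_orthogonalProjectionOnto_eq_of_mem_right,
    Submodule.inner_orthogonalProjectionOnto_eq_of_mem_left]
  exact hA.inner_apply _ _

/-- If `x, A x, …, A ^ d x` lie in `V` then polynomials of degree at most `d` in `A` and in its
compression to `V` act on `x` in the same way. -/
theorem aeval_compression_apply {x : H} {d : ℕ} (hx : ∀ k ≤ d, (A ^ k) x ∈ V) {p : Polynomial ℂ}
    (hp : p.natDegree ≤ d) :
    (Polynomial.aeval (compression V A) p (V.orthogonalProjectionOnto x) : H) =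
      Polynomial.aeval A p x := by
  have h1 : ∀ k ≤ d, (((compression V A) ^ k) (V.orthogonalProjectionOnto x) : H) = (A ^ k) x := by
    intro k
    induction k with
    | zero =>
      intro _
      exact Submodule.starProjection_eq_self_iff.2 (hx 0 (Nat.zero_le d))
    | succ k ih =>
      intro hk
      rw [pow_succ', pow_succ']
      change ((V.orthogonalProjectionOnto
        (A (((compression V A) ^ k) (V.orthogonalProjectionOnto x)))) : H) =
        A ((A ^ k) x)
      rw [ih (by omega)]
      have := hx (k + 1) hk
      rw [pow_succ'] at this
      exact Submodule.starProjection_eq_self_iff.2 this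
  rw [Polynomial.aeval_eq_sum_range, Polynomial.aeval_eq_sum_range, sum_apply, sum_apply,
    Submodule.coe_sum]
  refine Finset.sum_congr rfl fun k hk => ?_
  have hk' : k ≤ d := by
    have := Finset.mem_range.1 hk
    omega
  rw [smul_apply, smul_apply, Submodule.coe_smul, h1 k hk']

/-- One subspace serves both operators: the span of the images of `V₀` under the powers of `A` and
`B` up to the degree of `p`. -/
theorem exists_compression_aeval (A B : H →L[ℂ] H) (V₀ : Submodule ℂ H) [FiniteDimensional ℂ V₀]
    (p : Polynomial ℂ) : ∃ (V : Submodule ℂ H) (_ : FiniteDimensional ℂ V), ∀ x ∈ V₀,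
      (Polynomial.aeval (compression V A) p (V.orthogonalProjectionOnto x) : H) =
        Polynomial.aeval A p x ∧
      (Polynomial.aeval (compression V B) p (V.orthogonalProjectionOnto x) : H) =
        Polynomial.aeval B p x := by
  let d := p.natDegree
  let VA : Fin (d + 1) → Submodule ℂ H := fun k => V₀.map ((A ^ (k : ℕ) : H →L[ℂ] H) : H →ₗ[ℂ] H)
  let VB : Fin (d + 1) → Submodule ℂ H := fun k => V₀.map ((B ^ (k : ℕ) : H →L[ℂ] H) : H →ₗ[ℂ] H)
  have hfd : FiniteDimensional ℂ ((⨆ k, VA k) ⊔ (⨆ k, VB k) : Submodule ℂ H) := inferInstance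
  refine ⟨(⨆ k, VA k) ⊔ (⨆ k, VB k), hfd, fun x hx => ⟨?_, ?_⟩⟩
  · refine aeval_compression_apply (d := d) (fun k hk => ?_) le_rfl
    refine Submodule.mem_sup_left (Submodule.mem_iSup_of_mem (⟨k, by omega⟩ : Fin (d + 1)) ?_)
    exact Submodule.mem_map_of_mem (f := ((A ^ k : H →L[ℂ] H) : H →ₗ[ℂ] H)) hx
  · refine aeval_compression_apply (d := d) (fun k hk => ?_) le_rfl
    refine Submodule.mem_sup_right (Submodule.mem_iSup_of_mem (⟨k, by omega⟩ : Fin (d + 1)) ?_)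
    exact Submodule.mem_map_of_mem (f := ((B ^ k : H →L[ℂ] H) : H →ₗ[ℂ] H)) hx

end compression

namespace SymmetricNorm

variable {N : SymmetricNorm.{u}} {f : ℝ → ℂ} {δ C : ℝ}

/-- A Lipschitz estimate on finite-dimensional spaces extends to all Hilbert spaces: on a given
finite-dimensional subspace, a polynomial in `A` agrees with the same polynomial in a compression of
`A` to a larger finite-dimensional subspace. -/
theorem LipschitzFor.le_opFun_sub (hf : N.LipschitzFor f δ C) (hC : 0 ≤ C)
    (hcont : ContinuousOn f (Set.Icc (-δ) δ)) {H : Type u} [NormedAddCommGroup H]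
    [InnerProductSpace ℂ H] [CompleteSpace H] {A B : H →L[ℂ] H} (hA : IsSelfAdjoint A)
    (hB : IsSelfAdjoint B) (hAδ : ‖A‖ ≤ δ) (hBδ : ‖B‖ ≤ δ) {M : ℝ} (hM : 0 < M)
    (h : N.le (A - B) M) : N.le (opFun f A - opFun f B) (C * M) := by
  refine N.of_compression (by positivity) fun V₀ _ Y hY => N.of_forall_pos fun η hη => ?_
  set d : ℝ := Module.finrank ℂ V₀ + 1 with hd
  have hd0 : 0 < d := by positivity
  set ε := η / (4 * d) with hε
  have hε0 : 0 < ε := by positivity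
  obtain ⟨p, hp⟩ := exists_polynomial_near_complex hcont hε0
  obtain ⟨V, hV, hVp⟩ := exists_compression_aeval A B V₀ p
  have : CompleteSpace V := FiniteDimensional.complete ℂ V
  set a := compression V A
  set b := compression V B
  have ha : IsSelfAdjoint a := isSelfAdjoint_compression hA
  have hb : IsSelfAdjoint b := isSelfAdjoint_compression hB
  have haδ : ‖a‖ ≤ δ := (norm_compression_le A).trans hAδ
  have hbδ : ‖b‖ ≤ δ := (norm_compression_le B).trans hBδ
  have hab : N.le (a - b) M := by
    have := N.comp_le_one hM.le h V.orthogonalProjectionOnto_norm_le (norm_subtypeL_le_one V)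
    rw [← compression_sub]
    exact this
  set P : V₀ →L[ℂ] V := V.orthogonalProjectionOnto ∘L V₀.subtypeL
  have hP : ‖P‖ ≤ 1 := (ContinuousLinearMap.opNorm_comp_le _ _).trans
    (mul_le_one₀ V.orthogonalProjectionOnto_norm_le (norm_nonneg _) (norm_subtypeL_le_one V₀))
  set Q : V →L[ℂ] V₀ := Y ∘L V.subtypeL
  have hQ : ‖Q‖ ≤ 1 := (ContinuousLinearMap.opNorm_comp_le _ _).trans
    (mul_le_one₀ hY (norm_nonneg _) (norm_subtypeL_le_one V))
  have h1 : N.le (Q ∘L (opFun f a - opFun f b) ∘L P) (C * M) :=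
    N.comp_le_one (by positivity) (hf V a b ha hb haδ hbδ M hM hab) hQ hP
  have e : ∀ (A : H →L[ℂ] H) (a : V →L[ℂ] V), (∀ x ∈ V₀,
      (Polynomial.aeval a p (V.orthogonalProjectionOnto x) : H) = Polynomial.aeval A p x) →
      Y ∘L opFun f A ∘L V₀.subtypeL - Q ∘L opFun f a ∘L P =
      Y ∘L (opFun f A - Polynomial.aeval A p) ∘L V₀.subtypeL -
      Q ∘L (opFun f a - Polynomial.aeval a p) ∘L P := by
    intro A a hAa
    have : Y ∘L Polynomial.aeval A p ∘L V₀.subtypeL = Q ∘L Polynomial.aeval a p ∘L P := by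
      ext1 x
      exact congrArg Y (hAa x x.2).symm
    simp only [ContinuousLinearMap.comp_sub, ContinuousLinearMap.sub_comp, this]
    abel
  have hn : ∀ (A : H →L[ℂ] H) (a : V →L[ℂ] V), IsSelfAdjoint A → IsSelfAdjoint a → ‖A‖ ≤ δ →
      ‖a‖ ≤ δ → (∀ x ∈ V₀,
      (Polynomial.aeval a p (V.orthogonalProjectionOnto x) : H) = Polynomial.aeval A p x) →
      ‖Y ∘L opFun f A ∘L V₀.subtypeL - Q ∘L opFun f a ∘L P‖ ≤ 2 * ε := by
    intro A a hA ha hAδ haδ hAa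
    rw [e A a hAa, two_mul]
    refine (norm_sub_le (E := V₀ →L[ℂ] V₀) _ _).trans (add_le_add ?_ ?_)
    · exact (norm_comp_comp_le_of_le_one hY (norm_subtypeL_le_one V₀) _).trans
        (norm_opFun_sub_aeval_le hcont hA hAδ hε0.le hp)
    · exact (norm_comp_comp_le_of_le_one hQ hP _).trans
        (norm_opFun_sub_aeval_le hcont ha haδ hε0.le hp)
  have hnA := hn A a hA ha hAδ haδ fun x hx => (hVp x hx).1
  have hnB := hn B b hB hb hBδ hbδ fun x hx => (hVp x hx).2
  set D := (Y ∘L opFun f A ∘L V₀.subtypeL - Q ∘L opFun f a ∘L P) -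
    (Y ∘L opFun f B ∘L V₀.subtypeL - Q ∘L opFun f b ∘L P) with hD
  have hDn : ‖D‖ ≤ 4 * ε := by
    refine (norm_sub_le (E := V₀ →L[ℂ] V₀) _ _).trans ((add_le_add hnA hnB).trans (le_of_eq ?_))
    ring
  have h2 := N.add h1 (N.mono (N.of_norm D) (mul_le_mul_of_nonneg_left hDn hd0.le))
  have e1 : Q ∘L (opFun f a - opFun f b) ∘L P + D =
      Y ∘L (opFun f A - opFun f B) ∘L V₀.subtypeL := by
    rw [hD]
    simp only [ContinuousLinearMap.comp_sub, ContinuousLinearMap.sub_comp]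
    abel
  rw [e1] at h2
  have e2 : d * (4 * ε) = η := by rw [hε]; field_simp
  rwa [e2] at h2

/-- Scalar operators show that a function which is Lipschitz for some unitarily invariant norm is
Lipschitz. -/
theorem LipschitzFor.continuousOn (hf : N.LipschitzFor f δ C) (hC : 0 ≤ C) :
    ContinuousOn f (Set.Icc (-δ) δ) := by
  let E := EuclideanSpace ℂ (ULift.{u} (Fin 1))
  let S : ℝ → E →L[ℂ] E := fun t => (t : ℂ) • 1
  have hS1 : ‖(1 : E →L[ℂ] E)‖ ≤ 1 := ContinuousLinearMap.norm_id_le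
  have hSn : ∀ t, ‖S t‖ ≤ |t| := fun t => by
    rw [norm_smul, Complex.norm_real, Real.norm_eq_abs]
    exact mul_le_of_le_one_right (abs_nonneg t) hS1
  have hSsa : ∀ t, IsSelfAdjoint (S t) := fun t => by
    rw [IsSelfAdjoint, star_smul, star_one]
    simp [S]
  have hSf : ∀ t, ∀ x, opFun f (S t) x = f t • x := fun t x =>
    opFun_apply_eq_smul_of_finiteDimensional f (hSsa t) (by simp [S])
  let e : E := EuclideanSpace.single ⟨0⟩ 1
  have he : ‖e‖ = 1 := PiLp.norm_single 2 _ _ _ |>.trans norm_one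
  have hlip : ∀ s ∈ Set.Icc (-δ) δ, ∀ t ∈ Set.Icc (-δ) δ, ‖f s - f t‖ ≤ C * 2 * |s - t| := by
    intro s hs t ht
    rcases eq_or_ne s t with rfl | hst
    · simp
    have hpos : 0 < |s - t| := abs_pos.2 (sub_ne_zero.2 hst)
    have hfin : Module.finrank ℂ E = 1 := by simp [E]
    have h1 := N.mono (N.of_norm (S s - S t)) (N := 2 * |s - t|) (by
      rw [hfin]
      have : S s - S t = S (s - t) := by
        change (s : ℂ) • 1 - (t : ℂ) • 1 = ((s - t : ℝ) : ℂ) • (1 : E →L[ℂ] E)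
        rw [Complex.ofReal_sub]
        exact (sub_smul (s : ℂ) (t : ℂ) (1 : E →L[ℂ] E)).symm
      rw [this, Nat.cast_one, one_add_one_eq_two]
      exact mul_le_mul_of_nonneg_left (hSn _) zero_le_two)
    have h2 := N.norm_le (hf E (S s) (S t) (hSsa s) (hSsa t) ((hSn s).trans (abs_le.2 hs))
      ((hSn t).trans (abs_le.2 ht)) _ (by positivity) h1)
    have h3 := (opFun f (S s) - opFun f (S t)).le_of_opNorm_le h2 e
    rw [sub_apply, hSf, hSf, ← sub_smul, norm_smul, he, mul_one, mul_one] at h3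
    rwa [mul_assoc]
  have : LipschitzOnWith (Real.toNNReal (C * 2)) f (Set.Icc (-δ) δ) :=
    LipschitzOnWith.of_dist_le_mul fun s hs t ht => by
      rw [dist_eq_norm, Real.dist_eq, Real.coe_toNNReal _ (by positivity)]
      exact hlip s hs t ht
  exact this.continuousOn

end SymmetricNorm

/-! ### Compact operators: sufficiency of the operator Lipschitz condition -/

section compactSpectral

variable {H : Type u} [NormedAddCommGroup H] [InnerProductSpace ℂ H] [CompleteSpace H]
  {A B : H →L[ℂ] H}

theorem mem_eigenspace_iff_apply {t : ℝ} {x : H} :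
    x ∈ Module.End.eigenspace (A : Module.End ℂ H) (t : ℂ) ↔ A x = (t : ℂ) • x :=
  Module.End.mem_eigenspace_iff

theorem apply_eigenProj (A : H →L[ℂ] H) (t : ℝ) (x : H) :
    A (eigenProj A t x) = (t : ℂ) • eigenProj A t x :=
  mem_eigenspace_iff_apply.1 (Submodule.starProjection_apply_mem _ x)

theorem eigenProj_apply_of_apply_eq_smul {t : ℝ} {x : H} (hx : A x = (t : ℂ) • x) :
    eigenProj A t x = x :=
  Submodule.starProjection_eq_self_iff.2 (mem_eigenspace_iff_apply.2 hx)

theorem inner_eq_zero_of_apply_eq_smul (hA : IsSelfAdjoint A) {s t : ℝ} (hst : s ≠ t) {x y : H}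
    (hx : A x = (s : ℂ) • x) (hy : A y = (t : ℂ) • y) : inner ℂ x y = 0 := by
  have h := hA.inner_apply x y
  rw [hx, hy, inner_smul_left, inner_smul_right, Complex.conj_ofReal, ← sub_eq_zero,
    ← sub_mul, mul_eq_zero, sub_eq_zero] at h
  exact h.resolve_left fun h => hst (Complex.ofReal_injective h)

theorem eigenProj_apply_of_apply_eq_smul_of_ne (hA : IsSelfAdjoint A) {s t : ℝ} (hst : s ≠ t)
    {x : H} (hx : A x = (s : ℂ) • x) : eigenProj A t x = 0 := by
  rw [eigenProj, Submodule.starProjection_apply_eq_zero_iff, Submodule.mem_orthogonal]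
  exact fun y hy => inner_eq_zero_of_apply_eq_smul hA hst.symm (mem_eigenspace_iff_apply.1 hy) hx

/-- The spectral theorem: `∑ P_t = 1` strongly, for the eigenprojections `P_t` of a compact
self-adjoint operator. -/
theorem hasSum_eigenProj (hAc : IsCompactOperator A) (hA : IsSelfAdjoint A) (x : H) :
    HasSum (fun t : ℝ => eigenProj A t x) x := by
  have hs : (A : H →ₗ[ℂ] H).IsSymmetric := hA.isSymmetric
  let F : ℝ → Submodule ℂ H := fun t => Module.End.eigenspace (A : Module.End ℂ H) (t : ℂ)
  have hF : OrthogonalFamily ℂ (fun t => F t) fun t => (F t).subtypeₗᵢ :=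
    hs.orthogonalFamily_eigenspaces.comp Complex.ofReal_injective
  have hle : (⨆ μ : ℂ, Module.End.eigenspace (A : Module.End ℂ H) μ) ≤ ⨆ t, F t := by
    refine iSup_le fun μ => ?_
    by_cases hμ : Module.End.HasEigenvalue (A : Module.End ℂ H) μ
    · have h1 := hs.conj_eigenvalue_eq_self hμ
      have h2 : ((μ.re : ℝ) : ℂ) = μ := Complex.conj_eq_iff_re.1 h1
      rw [← h2]
      exact le_iSup F μ.re
    · rw [Module.End.hasEigenvalue_iff, not_not] at hμ
      rw [hμ]
      exact bot_le
  have htop : ⊤ ≤ (⨆ t, F t).topologicalClosure := by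
    rw [top_le_iff, Submodule.topologicalClosure_eq_top_iff, eq_bot_iff,
      ← ContinuousLinearMap.orthogonalComplement_iSup_eigenspaces_eq_bot hAc hs]
    exact Submodule.orthogonal_le hle
  have hsum : IsHilbertSum ℂ (fun t => F t) fun t => (F t).subtypeₗᵢ :=
    IsHilbertSum.mkInternal F hF htop
  have h1 := hsum.hasSum_linearIsometryEquiv_symm (hsum.linearIsometryEquiv x)
  rw [LinearIsometryEquiv.symm_apply_apply] at h1
  -- The components of `x` in the Hilbert sum of the eigenspaces are `P_t x`.
  have h2 : ∀ t, eigenProj A t x = (F t).subtypeₗᵢ (hsum.linearIsometryEquiv x t) := by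
    intro t
    have h3 := h1.mapL (eigenProj A t)
    refine h3.unique ?_
    have h4 := hasSum_single (f := fun s => eigenProj A t
      ((F s).subtypeₗᵢ (hsum.linearIsometryEquiv x s))) t fun s hst =>
        eigenProj_apply_of_apply_eq_smul_of_ne hA hst
          (mem_eigenspace_iff_apply.1 (hsum.linearIsometryEquiv x s).2)
    have h5 : eigenProj A t ((F t).subtypeₗᵢ (hsum.linearIsometryEquiv x t)) =
        (F t).subtypeₗᵢ (hsum.linearIsometryEquiv x t) := eigenProj_apply_of_apply_eq_smul
      (mem_eigenspace_iff_apply.1 (hsum.linearIsometryEquiv x t).2)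
    rwa [h5] at h4
  simpa only [h2] using h1

/-- The eigenvalues of `A` of modulus greater than `δ`. -/
def largeEigenvalues (A : H →L[ℂ] H) (δ : ℝ) : Set ℝ :=
  {t | δ < |t| ∧ ∃ x, A x = (t : ℂ) • x ∧ ‖x‖ = 1}

theorem finite_largeEigenvalues (hAc : IsCompactOperator A) (hA : IsSelfAdjoint A) {δ : ℝ}
    (hδ : 0 < δ) : (largeEigenvalues A δ).Finite := by
  by_contra hinf
  let t : ℕ ↪ largeEigenvalues A δ := Set.Infinite.natEmbedding _ hinf
  have ht : ∀ n, δ < |(t n : ℝ)| := fun n => (t n).2.1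
  choose e he hen using fun n => (t n).2.2
  obtain ⟨K, hK, hKA⟩ := hAc.image_closedBall_subset_compact (f := (A : H →ₗ[ℂ] H)) 1
  obtain ⟨a, -, φ, hφ, hlim⟩ := hK.tendsto_subseq (x := fun n => A (e n)) fun n =>
    hKA ⟨e n, by simp [hen n], rfl⟩
  obtain ⟨n, hn⟩ := Metric.cauchySeq_iff.1 hlim.cauchySeq δ hδ
  have h1 := hn n le_rfl (n + 1) (Nat.le_succ n)
  set i := φ n
  set j := φ (n + 1)
  have hij : i ≠ j := (hφ (Nat.lt_succ_self n)).ne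
  have hts : (t i : ℝ) ≠ t j := fun h => hij (t.injective (Subtype.ext h))
  -- The vectors `A (e i)` and `A (e j)` are orthogonal and longer than `δ`, so they cannot be
  -- close.
  have h2 : ‖A (e i) - A (e j)‖ * ‖A (e i) - A (e j)‖ =
      ‖A (e i)‖ * ‖A (e i)‖ + ‖-A (e j)‖ * ‖-A (e j)‖ := by
    rw [sub_eq_add_neg]
    refine norm_add_sq_eq_norm_sq_add_norm_sq_of_inner_eq_zero (𝕜 := ℂ) _ _ ?_
    rw [inner_neg_right, he, he, inner_smul_left, inner_smul_right,
      inner_eq_zero_of_apply_eq_smul hA hts (he i) (he j)]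
    simp
  have h3 : δ < ‖A (e i)‖ := by
    rw [he, norm_smul, hen, mul_one, Complex.norm_real]
    exact ht i
  rw [Function.comp_apply, Function.comp_apply, dist_eq_norm] at h1
  change ‖A (e i) - A (e j)‖ < δ at h1
  nlinarith [norm_nonneg (A (e i) - A (e j)), norm_nonneg (-A (e j))]

theorem eigenProj_eq_zero_of_notMem {δ t : ℝ} (ht : δ < |t|) (ht' : t ∉ largeEigenvalues A δ) :
    eigenProj A t = 0 := by
  ext x
  by_contra hx
  rw [zero_apply] at hx
  refine ht' ⟨ht, ((‖eigenProj A t x‖ : ℂ)⁻¹) • eigenProj A t x, ?_, ?_⟩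
  · rw [map_smul, apply_eigenProj, smul_comm]
  · rw [norm_smul]
    simp [hx]

theorem exists_traceNormLE_eigenProj (hAc : IsCompactOperator A) {t : ℝ} (ht : t ≠ 0) :
    ∃ M, TraceNormLE (eigenProj A t) M := by
  have : FiniteDimensional ℂ (Module.End.eigenspace (A : Module.End ℂ H) (t : ℂ)) :=
    ContinuousLinearMap.finite_dimensional_eigenspace hAc _ (by simpa using ht)
  exact ⟨_, TraceNormLE.of_factor
    (Module.End.eigenspace (A : Module.End ℂ H) (t : ℂ)).subtypeL
    (Module.End.eigenspace (A : Module.End ℂ H) (t : ℂ)).orthogonalProjectionOnto⟩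

theorem hasSum_smul_eigenProj_of_continuous (hAc : IsCompactOperator A) (hA : IsSelfAdjoint A)
    {g : ℝ → ℂ} (hg : Continuous g) (x : H) :
    HasSum (fun t : ℝ => g t • eigenProj A t x) (opFun g A x) := by
  have h := (hasSum_eigenProj hAc hA x).mapL (opFun g A)
  convert h using 2 with t
  exact (opFun_apply_eq_smul (δ := ‖A‖) hg.continuousOn hA le_rfl (apply_eigenProj A t x)).symm

/-- Changing a continuous function away from a neighbourhood of `0` changes `g(A)` by an operator of
finite rank. -/
theorem exists_hasSum_smul_eigenProj (hAc : IsCompactOperator A) (hA : IsSelfAdjoint A)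
    {f g : ℝ → ℂ} (hg : Continuous g) {δ : ℝ} (hδ : 0 < δ) (hfg : ∀ t, |t| ≤ δ → f t = g t) :
    ∃ (F : H →L[ℂ] H) (M : ℝ), TraceNormLE F M ∧
      ∀ x, HasSum (fun t : ℝ => f t • eigenProj A t x) (opFun g A x + F x) := by
  have hfin := finite_largeEigenvalues hAc hA hδ
  have hM : ∀ t : ℝ, ∃ M, t ∈ hfin.toFinset → TraceNormLE ((f t - g t) • eigenProj A t) M := by
    intro t
    by_cases ht : t ∈ hfin.toFinset
    · have h1 : δ < |t| := (hfin.mem_toFinset.1 ht).1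
      obtain ⟨M, hM⟩ := exists_traceNormLE_eigenProj hAc (t := t) (abs_pos.1 (hδ.trans h1))
      exact ⟨_, fun _ => hM.smul _⟩
    · exact ⟨0, fun h => absurd h ht⟩
  choose M hM using hM
  refine ⟨∑ t ∈ hfin.toFinset, (f t - g t) • eigenProj A t, _, TraceNormLE.sum _ hM, fun x => ?_⟩
  have h1 := hasSum_smul_eigenProj_of_continuous hAc hA hg x
  have h2 : HasSum (fun t : ℝ => (f t - g t) • eigenProj A t x)
      (∑ t ∈ hfin.toFinset, (f t - g t) • eigenProj A t x) := by
    refine hasSum_sum_of_ne_finset_zero fun t ht => ?_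
    rcases le_or_gt |t| δ with h | h
    · rw [hfg t h, sub_self, zero_smul]
    · rw [eigenProj_eq_zero_of_notMem h fun h' => ht (hfin.mem_toFinset.2 h'),
        zero_apply, smul_zero]
  have h3 := h1.add h2
  rw [sum_apply]
  simpa only [← add_smul, add_sub_cancel, smul_apply] using h3

/-- The truncation of a real number to `[-δ, δ]`. -/
noncomputable def clamp (δ t : ℝ) : ℝ := max (-δ) (min δ t)

theorem continuous_clamp (δ : ℝ) : Continuous (clamp δ) := by
  unfold clamp
  fun_prop

theorem clamp_mem {δ : ℝ} (hδ : 0 ≤ δ) (t : ℝ) : clamp δ t ∈ Set.Icc (-δ) δ :=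
  ⟨le_max_left _ _, max_le (by linarith) (min_le_left _ _)⟩

theorem clamp_eq_self {δ t : ℝ} (h : |t| ≤ δ) : clamp δ t = t := by
  rw [abs_le] at h
  rw [clamp, min_eq_right h.2, max_eq_right h.1]

/-- The truncation of a self-adjoint operator to norm at most `δ`. -/
noncomputable def clampOp (δ : ℝ) (A : H →L[ℂ] H) : H →L[ℂ] H :=
  opFun (fun t => (clamp δ t : ℂ)) A

theorem isSelfAdjoint_clampOp (δ : ℝ) (A : H →L[ℂ] H) : IsSelfAdjoint (clampOp δ A) := by
  rw [IsSelfAdjoint, clampOp, opFun, ← cfc_star]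
  simp

theorem norm_clampOp_le {δ : ℝ} (hδ : 0 ≤ δ) (A : H →L[ℂ] H) : ‖clampOp δ A‖ ≤ δ :=
  norm_cfc_le hδ fun z _ => by
    rw [Complex.norm_real]
    exact abs_le.2 (clamp_mem hδ z.re)

theorem opFun_clampOp {f : ℝ → ℂ} {δ : ℝ} (hδ : 0 ≤ δ) (hf : ContinuousOn f (Set.Icc (-δ) δ))
    (hA : IsSelfAdjoint A) : opFun f (clampOp δ A) = opFun (fun t => f (clamp δ t)) A := by
  have := hA.isStarNormal
  have hc := continuous_clamp δ
  unfold opFun clampOp opFun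
  have h1 : ContinuousOn (fun z : ℂ => f z.re)
      ((fun z : ℂ => (clamp δ z.re : ℂ)) '' spectrum ℂ A) := by
    refine hf.comp Complex.continuous_re.continuousOn ?_
    rintro _ ⟨z, -, rfl⟩
    simpa using clamp_mem hδ z.re
  have h2 : Continuous fun z : ℂ => (clamp δ z.re : ℂ) := by fun_prop
  rw [← cfc_comp' (fun z : ℂ => f z.re) (fun z : ℂ => (clamp δ z.re : ℂ)) A h1 h2.continuousOn]
  simp

/-- A compact self-adjoint operator differs from its truncation by an operator of finite trace
norm. -/
theorem exists_sub_clampOp (hAc : IsCompactOperator A) (hA : IsSelfAdjoint A) {δ : ℝ}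
    (hδ : 0 < δ) : ∃ (F : H →L[ℂ] H) (M : ℝ), TraceNormLE F M ∧ A = clampOp δ A + F := by
  have hc := continuous_clamp δ
  obtain ⟨F, M, hF, h⟩ := exists_hasSum_smul_eigenProj hAc hA (f := fun t => (t : ℂ))
    (g := fun t => (clamp δ t : ℂ)) (by fun_prop) hδ fun t ht => by rw [clamp_eq_self ht]
  refine ⟨F, M, hF, ContinuousLinearMap.ext fun x => ?_⟩
  have h1 := (hasSum_eigenProj hAc hA x).mapL A
  simp only [apply_eigenProj] at h1
  exact h1.unique (h x)

/-- If `f` is continuous near `0` then `f(A)` is everywhere defined, and differs from `f` of the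
truncation of `A` by an operator of finite trace norm, whatever `f` is elsewhere. -/
theorem exists_hasSum_opFun_clampOp (hAc : IsCompactOperator A) (hA : IsSelfAdjoint A) {δ : ℝ}
    (hδ : 0 < δ) {f : ℝ → ℂ} (hf : ContinuousOn f (Set.Icc (-δ) δ)) :
    ∃ (F : H →L[ℂ] H) (M : ℝ), TraceNormLE F M ∧
      ∀ x, HasSum (fun t : ℝ => f t • eigenProj A t x) ((opFun f (clampOp δ A) + F) x) := by
  rw [opFun_clampOp hδ.le hf hA]
  exact exists_hasSum_smul_eigenProj hAc hA
    (hf.comp_continuous (continuous_clamp δ) (clamp_mem hδ.le)) hδ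
    fun t ht => by rw [clamp_eq_self ht]

/-- If the two spectral series converge everywhere then the difference is defined on all of `H`. -/
theorem isTraceClassPMap_sub_of_hasSum {f : ℝ → ℂ} {S T : H →L[ℂ] H}
    (hS : ∀ x, HasSum (fun t : ℝ => f t • eigenProj A t x) (S x))
    (hT : ∀ x, HasSum (fun t : ℝ => f t • eigenProj B t x) (T x)) (h : IsTraceClass (S - T)) :
    IsTraceClassPMap (compactFunCalc f A - compactFunCalc f B) := by
  refine ⟨?_, S - T, h, fun x => ?_⟩
  · have : (compactFunCalc f A - compactFunCalc f B).domain = ⊤ :=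
      eq_top_iff.2 fun x _ => ⟨(hS x).summable, (hT x).summable⟩
    rw [this]
    exact dense_univ
  · rw [LinearPMap.sub_apply, sub_apply]
    exact congrArg₂ (· - ·) (hS x).tsum_eq (hT x).tsum_eq

/-- Operator Lipschitz functions near `0` preserve trace class perturbations of compact self-adjoint
operators. -/
theorem isTraceClassPMap_of_isOperatorLipschitzOn {f : ℝ → ℂ} {δ : ℝ} (hδ : 0 < δ)
    (hf : IsOperatorLipschitzOn.{v} f (Set.Icc (-δ) δ)) (hAc : IsCompactOperator A)
    (hBc : IsCompactOperator B) (hA : IsSelfAdjoint A) (hB : IsSelfAdjoint B)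
    (hAB : IsTraceClass (A - B)) : IsTraceClassPMap (compactFunCalc f A - compactFunCalc f B) := by
  obtain ⟨C, hC⟩ := hf
  have hC0 : 0 ≤ max C 0 := le_max_right _ _
  have h1 : SymmetricNorm.operator.{u}.LipschitzFor f δ (max C 0) :=
    SymmetricNorm.LipschitzFor.transport.{u, v} hC0 fun n a b ha hb haδ hbδ =>
      (hC _ a b ha hb (spectrum_real_subset_of_norm_le haδ)
        (spectrum_real_subset_of_norm_le hbδ)).trans
        (mul_le_mul_of_nonneg_right (le_max_left _ _) (norm_nonneg _))
  have h2 := h1.dual SymmetricNorm.isDual_operator_trace hC0 hδ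
  have hcont := h2.continuousOn (by positivity)
  have hδ2 : 0 < δ / 2 := by positivity
  obtain ⟨FA, MA, hFA, eA⟩ := exists_sub_clampOp hAc hA hδ2
  obtain ⟨FB, MB, hFB, eB⟩ := exists_sub_clampOp hBc hB hδ2
  obtain ⟨GA, NA, hGA, sA⟩ := exists_hasSum_opFun_clampOp hAc hA hδ2 hcont
  obtain ⟨GB, NB, hGB, sB⟩ := exists_hasSum_opFun_clampOp hBc hB hδ2 hcont
  obtain ⟨M, hM⟩ := hAB.exists_traceNormLE
  have h3 : TraceNormLE (clampOp (δ / 2) A - clampOp (δ / 2) B) (M + (MA + MB) + 1) := by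
    have e : clampOp (δ / 2) A - clampOp (δ / 2) B = (A - B) - (FA - FB) := by
      nth_rewrite 2 [eA]
      nth_rewrite 2 [eB]
      abel
    rw [e]
    exact (hM.sub (hFA.sub hFB)).mono (by linarith)
  have hpos : 0 < M + (MA + MB) + 1 := by
    have := hM.nonneg
    have := hFA.nonneg
    have := hFB.nonneg
    linarith
  have h4 : TraceNormLE (opFun f (clampOp (δ / 2) A) - opFun f (clampOp (δ / 2) B)) _ :=
    h2.le_opFun_sub (by positivity) hcont (isSelfAdjoint_clampOp _ A)
    (isSelfAdjoint_clampOp _ B) (norm_clampOp_le hδ2.le A) (norm_clampOp_le hδ2.le B) hpos h3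
  refine isTraceClassPMap_sub_of_hasSum sA sB ?_
  rw [add_sub_add_comm]
  exact (h4.add (hGA.sub hGB)).isTraceClass

end compactSpectral

/-! ### Pairs of operators expanded by a function -/

section pairs

theorem blockDiag_sub {ι : Type*} [Fintype ι] [DecidableEq ι] {E : ι → Type*}
    [∀ i, NormedAddCommGroup (E i)] [∀ i, InnerProductSpace ℂ (E i)] (A B : ∀ i, E i →L[ℂ] E i) :
    blockDiag A - blockDiag B = blockDiag fun i => A i - B i := by
  ext x i
  simp

/-- A pair of self-adjoint operators on a finite-dimensional space, of norm at most `δ`, whose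
difference has trace norm at most `M` while the difference of the functions `f` of them has trace
norm greater than `c`. -/
structure ExpandedPair (f : ℝ → ℂ) (δ M c : ℝ) where
  space : Type
  [normedAddCommGroup : NormedAddCommGroup space]
  [innerProductSpace : InnerProductSpace ℂ space]
  [completeSpace : CompleteSpace space]
  [finiteDimensional : FiniteDimensional ℂ space]
  fst : space →L[ℂ] space
  snd : space →L[ℂ] space
  isSelfAdjoint_fst : IsSelfAdjoint fst
  isSelfAdjoint_snd : IsSelfAdjoint snd
  norm_fst_le : ‖fst‖ ≤ δ
  norm_snd_le : ‖snd‖ ≤ δ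
  sub_le : TraceNormLE (fst - snd) M
  not_le : ¬ TraceNormLE (opFun f fst - opFun f snd) c

attribute [instance] ExpandedPair.normedAddCommGroup ExpandedPair.innerProductSpace
  ExpandedPair.completeSpace ExpandedPair.finiteDimensional

namespace ExpandedPair

variable {f : ℝ → ℂ} {δ M c : ℝ}

/-- One of the two halves of the segment joining the operators of a pair is expanded as much as
the segment itself. -/
theorem nonempty_half (P : ExpandedPair f δ M c) : Nonempty (ExpandedPair f δ (M / 2) (c / 2)) := by
  set D := (1 / 2 : ℂ) • (P.fst + P.snd) with hD
  have hDsa : IsSelfAdjoint D := by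
    rw [IsSelfAdjoint, hD, star_smul, star_add, P.isSelfAdjoint_fst.star_eq,
      P.isSelfAdjoint_snd.star_eq]
    simp
  have hDn : ‖D‖ ≤ δ := by
    rw [hD, norm_smul]
    have h1 := norm_add_le P.fst P.snd
    have h2 := P.norm_fst_le
    have h3 := P.norm_snd_le
    norm_num
    linarith
  have hhalf : TraceNormLE ((1 / 2 : ℂ) • (P.fst - P.snd)) (M / 2) :=
    (P.sub_le.smul _).mono (by norm_num; linarith)
  have h1 : P.fst - D = (1 / 2 : ℂ) • (P.fst - P.snd) := by
    rw [hD]; module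
  have h2 : D - P.snd = (1 / 2 : ℂ) • (P.fst - P.snd) := by
    rw [hD]; module
  by_cases h : TraceNormLE (opFun f P.fst - opFun f D) (c / 2)
  · refine ⟨{ space := P.space, fst := D, snd := P.snd, isSelfAdjoint_fst := hDsa
              isSelfAdjoint_snd := P.isSelfAdjoint_snd, norm_fst_le := hDn
              norm_snd_le := P.norm_snd_le, sub_le := h2 ▸ hhalf, not_le := fun h' => ?_ }⟩
    have := h.add h'
    rw [sub_add_sub_cancel, add_halves] at this
    exact P.not_le this
  · exact ⟨{ space := P.space, fst := P.fst, snd := D, isSelfAdjoint_fst := P.isSelfAdjoint_fst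
             isSelfAdjoint_snd := hDsa, norm_fst_le := P.norm_fst_le
             norm_snd_le := hDn, sub_le := h1 ▸ hhalf, not_le := h }⟩

/-- The direct sum of two copies of a pair. -/
theorem nonempty_double (P : ExpandedPair f δ M c) :
    Nonempty (ExpandedPair f δ (M * 2) (c * 2)) := by
  have hδ : 0 ≤ δ := (norm_nonneg _).trans P.norm_fst_le
  let E : Fin 2 → Type := fun _ => P.space
  let A : ∀ i, E i →L[ℂ] E i := fun _ => P.fst
  let B : ∀ i, E i →L[ℂ] E i := fun _ => P.snd
  have hA : ∀ i, IsSelfAdjoint (A i) := fun _ => P.isSelfAdjoint_fst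
  have hB : ∀ i, IsSelfAdjoint (B i) := fun _ => P.isSelfAdjoint_snd
  refine ⟨{ space := PiLp 2 E, fst := blockDiag A, snd := blockDiag B
            isSelfAdjoint_fst := isSelfAdjoint_blockDiag hA
            isSelfAdjoint_snd := isSelfAdjoint_blockDiag hB
            norm_fst_le := norm_blockDiag_le hδ fun _ => P.norm_fst_le
            norm_snd_le := norm_blockDiag_le hδ fun _ => P.norm_snd_le
            sub_le := ?_
            not_le := fun h => P.not_le (TraceNormLE.of_forall_opTrace fun W hW => ?_) }⟩
  · rw [blockDiag_sub]
    refine (TraceNormLE.blockDiag (M := fun _ => M) fun _ => P.sub_le).mono ?_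
    rw [Fin.sum_univ_two, mul_two]
  · rw [opFun_blockDiag f hA, opFun_blockDiag f hB, blockDiag_sub] at h
    let W' : ∀ i, E i →L[ℂ] E i := fun _ => W
    have h1 := h.norm_opTrace_comp_le_of_norm_le_one (W := blockDiag W')
      (norm_blockDiag_le zero_le_one fun _ => hW)
    have e : ∀ i, blockProj E i ∘L ((blockDiag fun i => opFun f (A i) - opFun f (B i)) ∘L
        blockDiag W') ∘L blockIncl E i = (opFun f P.fst - opFun f P.snd) ∘L W := by
      intro i
      ext x
      simp [A, B, W']
    rw [opTrace_blockDiag, Fin.sum_univ_two, e, e, ← mul_two, norm_mul] at h1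
    simpa using h1

/-- The size of the difference in an expanded pair can be changed by any power of `2` without loss
in the expansion. -/
theorem nonempty_zpow (P : ExpandedPair f δ M c) (k : ℤ) :
    Nonempty (ExpandedPair f δ (M * 2 ^ k) (c * 2 ^ k)) := by
  induction k using Int.induction_on with
  | zero => simpa using ⟨P⟩
  | succ k ih =>
    obtain ⟨Q⟩ := ih
    rw [zpow_add_one₀ two_ne_zero, ← mul_assoc, ← mul_assoc]
    exact Q.nonempty_double
  | pred k ih =>
    obtain ⟨Q⟩ := ih
    rw [zpow_sub_one₀ two_ne_zero, ← mul_assoc, ← mul_assoc, ← div_eq_mul_inv, ← div_eq_mul_inv]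
    exact Q.nonempty_half

/-- The constant `2 / η` is what remains after the size of the difference is adjusted to `η` up to a
factor `2`. -/
theorem nonempty_of_not_lipschitzFor {η : ℝ} (hη : 0 < η)
    (h : ¬ SymmetricNorm.trace.{0}.LipschitzFor f η (2 / η)) :
    Nonempty (ExpandedPair f η η 1) := by
  unfold SymmetricNorm.LipschitzFor at h
  push Not at h
  obtain ⟨E, _, _, _, _, A, B, hA, hB, hAn, hBn, M, hM, h1, h2⟩ := h
  let P : ExpandedPair f η M (2 / η * M) :=
    { space := E, fst := A, snd := B, isSelfAdjoint_fst := hA, isSelfAdjoint_snd := hB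
      norm_fst_le := hAn, norm_snd_le := hBn, sub_le := h1, not_le := h2 }
  -- `2 ^ k < η / M ≤ 2 ^ (k + 1)`: the difference becomes at most `η`, but not less than `η / 2`.
  obtain ⟨k, hk1, hk2⟩ := exists_mem_Ioc_zpow (x := η / M) (y := 2) (by positivity) one_lt_two
  obtain ⟨Q⟩ := P.nonempty_zpow k
  have h3 : M * 2 ^ k ≤ η := by
    rw [lt_div_iff₀ hM] at hk1
    linarith
  have h4 : 1 ≤ 2 / η * M * 2 ^ k := by
    rw [zpow_add_one₀ two_ne_zero, div_le_iff₀ hM] at hk2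
    rw [div_mul_eq_mul_div, div_mul_eq_mul_div, one_le_div hη]
    linarith
  exact ⟨{ space := Q.space, fst := Q.fst, snd := Q.snd, isSelfAdjoint_fst := Q.isSelfAdjoint_fst
           isSelfAdjoint_snd := Q.isSelfAdjoint_snd, norm_fst_le := Q.norm_fst_le
           norm_snd_le := Q.norm_snd_le, sub_le := Q.sub_le.mono h3
           not_le := fun h => Q.not_le (h.mono h4) }⟩

end ExpandedPair
end pairs

/-! ### Direct sums of finite-dimensional operators and necessity -/

section directSum

variable {H : Type u} [NormedAddCommGroup H] [InnerProductSpace ℂ H] [CompleteSpace H]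

theorem exists_orthonormal_sequence (hH : ¬ FiniteDimensional ℂ H) :
    ∃ e : ℕ → H, Orthonormal ℂ e := by
  obtain ⟨w, b, hb⟩ := exists_hilbertBasis ℂ H
  have hw : Infinite w := by
    by_contra hfin
    rw [not_infinite_iff_finite] at hfin
    have hfd : FiniteDimensional ℂ (Submodule.span ℂ (Set.range b)) :=
      FiniteDimensional.span_of_finite ℂ (Set.finite_range b)
    have h1 := b.dense_span
    rw [IsClosed.submodule_topologicalClosure_eq (Submodule.closed_of_finiteDimensional _)] at h1
    rw [h1] at hfd
    exact hH (Module.Finite.equiv (Submodule.topEquiv (R := ℂ) (M := H)))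
  exact ⟨fun n => b (Infinite.natEmbedding w n),
    b.orthonormal.comp _ (Infinite.natEmbedding w).injective⟩

/-- Countably many finite-dimensional spaces embed isometrically into an infinite-dimensional
Hilbert space, with mutually orthogonal ranges. -/
theorem exists_orthogonal_isometries (hH : ¬ FiniteDimensional ℂ H) (E : ℕ → Type)
    [∀ n, NormedAddCommGroup (E n)] [∀ n, InnerProductSpace ℂ (E n)]
    [∀ n, FiniteDimensional ℂ (E n)] :
    ∃ J : ∀ n, E n →ₗᵢ[ℂ] H, ∀ m n, m ≠ n → ∀ x y, inner ℂ (J m x) (J n y) = 0 := by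
  obtain ⟨e, he⟩ := exists_orthonormal_sequence hH
  let g : (Σ n, Fin (Module.finrank ℂ (E n))) → ℕ := Encodable.encode
  have hg : Function.Injective g := Encodable.encode_injective
  have hv : ∀ n, Orthonormal ℂ fun i : Fin (Module.finrank ℂ (E n)) => e (g ⟨n, i⟩) := fun n =>
    he.comp _ (hg.comp sigma_mk_injective)
  choose K hK using fun n => exists_linearIsometry_of_orthonormal (hv n)
  have hKs : ∀ n z, K n z = ∑ i, z i • e (g ⟨n, i⟩) := by
    intro n z
    have h1 := (EuclideanSpace.basisFun (Fin (Module.finrank ℂ (E n))) ℂ).sum_repr z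
    conv_lhs => rw [← h1]
    rw [map_sum]
    exact Finset.sum_congr rfl fun i _ => by rw [map_smul, hK]; simp
  refine ⟨fun n => (K n).comp (stdOrthonormalBasis ℂ (E n)).repr.toLinearIsometry,
    fun m n hmn x y => ?_⟩
  change inner ℂ (K m ((stdOrthonormalBasis ℂ (E m)).repr x))
    (K n ((stdOrthonormalBasis ℂ (E n)).repr y)) = 0
  rw [hKs, hKs, sum_inner]
  refine Finset.sum_eq_zero fun i _ => ?_
  rw [inner_sum]
  refine Finset.sum_eq_zero fun j _ => ?_
  rw [inner_smul_left, inner_smul_right, he.2 fun h => hmn (congrArg Sigma.fst (hg h))]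
  simp

variable {E : ℕ → Type} [∀ n, NormedAddCommGroup (E n)] [∀ n, InnerProductSpace ℂ (E n)]
  [∀ n, CompleteSpace (E n)] [∀ n, FiniteDimensional ℂ (E n)] {J : ∀ n, E n →L[ℂ] H}

/-- The transfer to `H` of an operator on `E n`. -/
noncomputable def transferOp (J : ∀ n, E n →L[ℂ] H) (n : ℕ) (T : E n →L[ℂ] E n) : H →L[ℂ] H :=
  J n ∘L T ∘L ContinuousLinearMap.adjoint (J n)

theorem norm_transferOp_le (hJ : ∀ n, ‖J n‖ ≤ 1) (n : ℕ) (T : E n →L[ℂ] E n) :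
    ‖transferOp J n T‖ ≤ ‖T‖ :=
  norm_comp_comp_le_of_le_one (hJ n) (by simpa using hJ n) T

theorem isSelfAdjoint_transferOp {n : ℕ} {T : E n →L[ℂ] E n} (hT : IsSelfAdjoint T) :
    IsSelfAdjoint (transferOp J n T) :=
  hT.conj_adjoint (J n)

theorem isCompactOperator_transferOp (n : ℕ) (T : E n →L[ℂ] E n) :
    IsCompactOperator (transferOp J n T) := by
  have hid : IsCompactOperator (id : E n → E n) :=
    (isCompactOperator_id_iff_finiteDimensional (𝕜 := ℂ)).2 inferInstance
  exact (hid.comp_clm (ContinuousLinearMap.adjoint (J n))).clm_comp (J n ∘L T)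

/-- The orthogonal direct sum of the operators `T n`, transferred to `H`. -/
theorem exists_hasSum_transferOp (hJ : ∀ n, ‖J n‖ ≤ 1) {T : ∀ n, E n →L[ℂ] E n}
    (hT : ∀ n, IsSelfAdjoint (T n)) (hTn : ∀ n, ‖T n‖ ≤ (1 / 2 : ℝ) ^ n) :
    ∃ S : H →L[ℂ] H, HasSum (fun n => transferOp J n (T n)) S ∧ IsSelfAdjoint S ∧
      IsCompactOperator S := by
  have hsum : Summable fun n => transferOp J n (T n) :=
    Summable.of_norm_bounded summable_geometric_two fun n =>
      (norm_transferOp_le hJ n _).trans (hTn n)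
  refine ⟨_, hsum.hasSum, ?_, ?_⟩
  · rw [IsSelfAdjoint, tsum_star]
    exact tsum_congr fun n => (isSelfAdjoint_transferOp (hT n)).star_eq
  · refine isCompactOperator_of_tendsto hsum.hasSum (.of_forall fun s => ?_)
    refine Finset.sum_induction (fun n => transferOp J n (T n))
      (fun S : H →L[ℂ] H => IsCompactOperator S) (fun a b ha hb => ?_) ?_ ?_
    · exact ha.add hb
    · exact isCompactOperator_zero
    · exact fun n _ => isCompactOperator_transferOp n _

/-- Each summand of an orthogonal direct sum is an invariant subspace. -/
theorem hasSum_transferOp_comp (hJ : ∀ n, ContinuousLinearMap.adjoint (J n) ∘L J n = 1)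
    (hJJ : ∀ m n, m ≠ n → ∀ x y, inner ℂ (J m x) (J n y) = 0) {T : ∀ n, E n →L[ℂ] E n}
    {S : H →L[ℂ] H} (hS : HasSum (fun n => transferOp J n (T n)) S) (n : ℕ) :
    S ∘L J n = J n ∘L T n := by
  ext x
  have h1 : HasSum (fun m => transferOp J m (T m) (J n x)) (S (J n x)) :=
    hS.mapL (ContinuousLinearMap.apply ℂ H (J n x))
  have h2 : ∀ m, m ≠ n → transferOp J m (T m) (J n x) = 0 := by
    intro m hm
    have : ContinuousLinearMap.adjoint (J m) (J n x) = 0 := by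
      refine ext_inner_left ℂ fun y => ?_
      rw [ContinuousLinearMap.adjoint_inner_right, hJJ m n hm, inner_zero_right]
    simp [transferOp, this]
  have h3 := hasSum_single (f := fun m => transferOp J m (T m) (J n x)) n h2
  have h4 : ContinuousLinearMap.adjoint (J n) (J n x) = x := congrArg (fun S => S x) (hJ n)
  rw [ContinuousLinearMap.comp_apply, h1.unique h3]
  simp [transferOp, h4]

/-- If `J` intertwines an operator `A` on a finite-dimensional space with `S`, then the range of
`J` lies in the domain of `f(S)`, for arbitrary `f`, and `J` intertwines `f(A)` with `f(S)`. -/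
theorem hasSum_smul_eigenProj_of_comp_eq {F : Type*} [NormedAddCommGroup F] [InnerProductSpace ℂ F]
    [CompleteSpace F] [FiniteDimensional ℂ F] {f : ℝ → ℂ} {S : H →L[ℂ] H} (hS : IsSelfAdjoint S)
    {A : F →L[ℂ] F} (hA : IsSelfAdjoint A) {J : F →L[ℂ] H} (hJ : S ∘L J = J ∘L A) (x : F) :
    HasSum (fun t : ℝ => f t • eigenProj S t (J x)) (J (opFun f A x)) := by
  have hs : (A : F →ₗ[ℂ] F).IsSymmetric := hA.isSymmetric
  set b := hs.eigenvectorBasis rfl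
  have hb : ∀ i, HasSum (fun t : ℝ => f t • eigenProj S t (J (b i))) (J (opFun f A (b i))) := by
    intro i
    set s := hs.eigenvalues rfl i
    have h1 : A (b i) = (s : ℂ) • b i := hs.apply_eigenvectorBasis rfl i
    have h2 : S (J (b i)) = (s : ℂ) • J (b i) := by
      rw [← map_smul, ← h1]
      exact congrArg (fun T : F →L[ℂ] H => T (b i)) hJ
    rw [opFun_apply_eq_smul_of_finiteDimensional f hA h1, map_smul]
    have h3 := hasSum_single (f := fun t : ℝ => f t • eigenProj S t (J (b i))) s fun t ht => by
      rw [eigenProj_apply_of_apply_eq_smul_of_ne hS ht.symm h2, smul_zero]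
    rwa [eigenProj_apply_of_apply_eq_smul h2] at h3
  have h := hasSum_sum (s := Finset.univ) fun i _ => (hb i).const_smul (b.repr x i)
  have e : ∀ T : F →L[ℂ] H, ∑ i, b.repr x i • T (b i) = T x := by
    intro T
    conv_rhs => rw [← b.sum_repr x]
    rw [map_sum]
    exact Finset.sum_congr rfl fun i _ => (map_smul _ _ _).symm
  have e1 := e (J ∘L opFun f A)
  simp only [ContinuousLinearMap.comp_apply] at e1
  rw [e1] at h
  convert h using 2 with t
  exact (e (f t • (eigenProj S t ∘L J))).symm

/-- If the blocks `T n` of `S` all have trace norm greater than `1` then `S` has infinite trace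
norm. -/
theorem not_traceNormLE_of_blocks (hJn : ∀ n, ‖J n‖ ≤ 1)
    (hJ : ∀ n, ContinuousLinearMap.adjoint (J n) ∘L J n = 1)
    (hJJ : ∀ m n, m ≠ n → ∀ x y, inner ℂ (J m x) (J n y) = 0) {T : ∀ n, E n →L[ℂ] E n}
    (hT : ∀ n, ¬ TraceNormLE (T n) 1) {S : H →L[ℂ] H} (hS : ∀ n, S ∘L J n = J n ∘L T n) (K : ℝ) :
    ¬ TraceNormLE S K := by
  intro hSK
  have hW : ∀ n, ∃ W : E n →L[ℂ] E n, ‖W‖ ≤ 1 ∧ 1 < (opTrace (T n ∘L W)).re := by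
    intro n
    by_contra! hcon
    refine hT n (TraceNormLE.of_forall_opTrace fun W hW => ?_)
    obtain ⟨c, hc, hc'⟩ := RCLike.exists_norm_eq_mul_self (opTrace (T n ∘L W))
    -- Rotating `W` by a phase makes the trace real and nonnegative.
    have h1 := hcon (c • W) (by rwa [norm_smul, hc, one_mul])
    rw [ContinuousLinearMap.comp_smul, opTrace_smul, ← hc'] at h1
    simpa using h1
  choose W hWn hWt using hW
  obtain ⟨N, hN⟩ := exists_nat_gt K
  let D : Fin N → Type := fun i => E i
  -- The compression of `S` by `X` and `Y*` has the diagonal blocks `W i T i`, so its trace has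
  -- real part at least `N`.
  let X : PiLp 2 D →L[ℂ] H := blockRow fun i : Fin N => J i
  let Y : PiLp 2 D →L[ℂ] H := blockRow fun i : Fin N => J i ∘L ContinuousLinearMap.adjoint (W i)
  have hX : ‖X‖ ≤ 1 := norm_blockRow_le zero_le_one (fun i => hJn i) fun i j hij x y =>
    hJJ i j (fun h => hij (Fin.ext h)) _ _
  have hY : ‖Y‖ ≤ 1 := norm_blockRow_le zero_le_one
    (fun i => (ContinuousLinearMap.opNorm_comp_le _ _).trans
      (mul_le_one₀ (hJn i) (norm_nonneg _) (by simpa using hWn i))) fun i j hij x y =>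
    hJJ i j (fun h => hij (Fin.ext h)) _ _
  have h1 := (hSK.comp_of_norm_le_one (Y := ContinuousLinearMap.adjoint Y) (X := X)
    (by simpa using hY) hX).norm_opTrace_comp_le_of_norm_le_one
    (W := ContinuousLinearMap.id ℂ _) ContinuousLinearMap.norm_id_le
  rw [ContinuousLinearMap.comp_id, opTrace_blockDiag] at h1
  have e : ∀ i : Fin N, opTrace (blockProj D i ∘L (ContinuousLinearMap.adjoint Y ∘L S ∘L X) ∘L
      blockIncl D i) = opTrace (T i ∘L W i) := by
    intro i
    have e1 : X ∘L blockIncl D i = J i := blockRow_comp_blockIncl _ i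
    have e2 : blockProj D i ∘L ContinuousLinearMap.adjoint Y =
        W i ∘L ContinuousLinearMap.adjoint (J i) := by
      have e3 : Y ∘L blockIncl D i = J i ∘L ContinuousLinearMap.adjoint (W i) :=
        blockRow_comp_blockIncl _ i
      have e4 := congrArg ContinuousLinearMap.adjoint e3
      rw [ContinuousLinearMap.adjoint_comp, ContinuousLinearMap.adjoint_comp,
        ContinuousLinearMap.adjoint_adjoint, adjoint_blockIncl] at e4
      exact e4
    have e5 : blockProj D i ∘L (ContinuousLinearMap.adjoint Y ∘L S ∘L X) ∘L blockIncl D i =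
        (blockProj D i ∘L ContinuousLinearMap.adjoint Y) ∘L S ∘L (X ∘L blockIncl D i) := rfl
    rw [e5, e1, e2, hS i]
    have e6 : (W i ∘L ContinuousLinearMap.adjoint (J i)) ∘L J i ∘L T i =
        W i ∘L (ContinuousLinearMap.adjoint (J i) ∘L J i) ∘L T i := rfl
    rw [e6, hJ i, opTrace_comp_comm]
    rfl
  rw [Finset.sum_congr rfl fun i _ => e i] at h1
  have h2 : (N : ℝ) ≤ ∑ i : Fin N, (opTrace (T i ∘L W i)).re := by
    have := Finset.card_nsmul_le_sum (Finset.univ : Finset (Fin N))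
      (fun i => (opTrace (T i ∘L W i)).re) 1 fun i _ => (hWt i).le
    simpa using this
  rw [← Complex.re_sum] at h2
  have h3 := Complex.re_le_norm (∑ i : Fin N, opTrace (T i ∘L W i))
  linarith

/-- If trace class perturbations of compact self-adjoint operators are preserved then `f` satisfies
a Lipschitz estimate in the trace norm on finite-dimensional spaces. Otherwise the direct sum of a
sequence of pairs with small differences would be a counterexample. -/
theorem exists_lipschitzFor_trace (hH : ¬ FiniteDimensional ℂ H) {f : ℝ → ℂ}
    (h : ∀ A B : H →L[ℂ] H, IsCompactOperator A → IsCompactOperator B →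
        IsSelfAdjoint A → IsSelfAdjoint B → IsTraceClass (A - B) →
        IsTraceClassPMap (compactFunCalc f A - compactFunCalc f B)) :
    ∃ δ C : ℝ, 0 < δ ∧ 0 ≤ C ∧ SymmetricNorm.trace.{0}.LipschitzFor f δ C := by
  by_contra! hcon
  have hη : ∀ n : ℕ, (0 : ℝ) < (1 / 2) ^ n := fun n => by positivity
  have hP : ∀ n : ℕ, Nonempty (ExpandedPair f ((1 / 2) ^ n) ((1 / 2) ^ n) 1) := fun n =>
    ExpandedPair.nonempty_of_not_lipschitzFor (hη n)
      (hcon _ _ (hη n) (div_pos two_pos (hη n)).le)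
  let P := fun n => (hP n).some
  obtain ⟨J₀, hJ₀⟩ := exists_orthogonal_isometries hH fun n => (P n).space
  let J : ∀ n, (P n).space →L[ℂ] H := fun n => (J₀ n).toContinuousLinearMap
  have hJn : ∀ n, ‖J n‖ ≤ 1 := fun n => (J₀ n).norm_toContinuousLinearMap_le
  have hJ : ∀ n, ContinuousLinearMap.adjoint (J n) ∘L J n = 1 := fun n =>
    (ContinuousLinearMap.norm_map_iff_adjoint_comp_self (J n)).1 (J₀ n).norm_map
  obtain ⟨A, hAs, hA, hAc⟩ := exists_hasSum_transferOp hJn (fun n => (P n).isSelfAdjoint_fst)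
    fun n => (P n).norm_fst_le
  obtain ⟨B, hBs, hB, hBc⟩ := exists_hasSum_transferOp hJn (fun n => (P n).isSelfAdjoint_snd)
    fun n => (P n).norm_snd_le
  have hAB : TraceNormLE (A - B) 2 := by
    refine TraceNormLE.hasSum (hAs.sub hBs) hasSum_geometric_two fun n => ?_
    have e : transferOp J n (P n).fst - transferOp J n (P n).snd =
        transferOp J n ((P n).fst - (P n).snd) := by
      simp [transferOp, ContinuousLinearMap.comp_sub, ContinuousLinearMap.sub_comp]
    rw [e]
    exact (P n).sub_le.comp_of_norm_le_one (hJn n) (by simpa using hJn n)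
  obtain ⟨-, S, hS, hSe⟩ := h A B hAc hBc hA hB hAB.isTraceClass
  obtain ⟨K, hK⟩ := hS.exists_traceNormLE
  refine not_traceNormLE_of_blocks hJn hJ hJ₀
    (T := fun n => opFun f (P n).fst - opFun f (P n).snd) (fun n => (P n).not_le)
    (fun n => ContinuousLinearMap.ext fun x => ?_) K hK
  have sA := hasSum_smul_eigenProj_of_comp_eq (f := f) hA (P n).isSelfAdjoint_fst
    (hasSum_transferOp_comp hJ hJ₀ hAs n) x
  have sB := hasSum_smul_eigenProj_of_comp_eq (f := f) hB (P n).isSelfAdjoint_snd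
    (hasSum_transferOp_comp hJ hJ₀ hBs n) x
  have h1 := hSe ⟨J n x, sA.summable, sB.summable⟩
  rw [LinearPMap.sub_apply] at h1
  have h2 : compactFunCalc f A ⟨J n x, sA.summable⟩ = J n (opFun f (P n).fst x) := sA.tsum_eq
  have h3 : compactFunCalc f B ⟨J n x, sB.summable⟩ = J n (opFun f (P n).snd x) := sB.tsum_eq
  rw [h2, h3] at h1
  rw [ContinuousLinearMap.comp_apply, ContinuousLinearMap.comp_apply, sub_apply, map_sub]
  exact h1.symm

end directSum

theorem SymmetricNorm.LipschitzFor.norm_opFun_sub_le {f : ℝ → ℂ} {δ C : ℝ}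
    (hf : operator.{u}.LipschitzFor f δ C) (hC : 0 ≤ C) {H : Type u} [NormedAddCommGroup H]
    [InnerProductSpace ℂ H] [CompleteSpace H] {A B : H →L[ℂ] H} (hA : IsSelfAdjoint A)
    (hB : IsSelfAdjoint B) (hAδ : ‖A‖ ≤ δ) (hBδ : ‖B‖ ≤ δ) :
    ‖opFun f A - opFun f B‖ ≤ C * ‖A - B‖ := by
  rcases eq_or_ne A B with rfl | hne
  · simp
  · exact hf.le_opFun_sub hC (hf.continuousOn hC) hA hB hAδ hBδ
      (norm_pos_iff.2 (sub_ne_zero.2 hne)) le_rfl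

theorem mainTheorem1 (H : Type u) [NormedAddCommGroup H] [InnerProductSpace ℂ H]
    [CompleteSpace H] (hH : ¬ FiniteDimensional ℂ H) (f : ℝ → ℂ) :
    (∀ A B : H →L[ℂ] H, IsCompactOperator A → IsCompactOperator B →
        IsSelfAdjoint A → IsSelfAdjoint B → IsTraceClass (A - B) →
        IsTraceClassPMap (compactFunCalc f A - compactFunCalc f B)) ↔
      ∃ δ : ℝ, 0 < δ ∧ IsOperatorLipschitzOn.{v} f (Set.Icc (-δ) δ) := by
  constructor
  · intro h
    obtain ⟨δ, C, hδ, hC, hf⟩ := exists_lipschitzFor_trace hH h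
    have h8 : 0 ≤ 8 * C := by positivity
    have h1 := hf.dual SymmetricNorm.isDual_trace_operator hC hδ
    have h2 : SymmetricNorm.operator.{v}.LipschitzFor f (δ / 2) (8 * C) :=
      SymmetricNorm.LipschitzFor.transport.{v, 0} h8 fun n A B hA hB hAδ hBδ =>
        h1.norm_opFun_sub_le h8 hA hB hAδ hBδ
    -- The radius is halved by the duality step.
    refine ⟨δ / 2, by positivity, 8 * C, fun K _ _ _ A B hA hB hAδ hBδ => ?_⟩
    exact h2.norm_opFun_sub_le h8 hA hB (norm_le_of_spectrum_real_subset hA (by positivity) hAδ)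
      (norm_le_of_spectrum_real_subset hB (by positivity) hBδ)
  · rintro ⟨δ, hδ, hf⟩ A B hAc hBc hA hB hAB
    exact isTraceClassPMap_of_isOperatorLipschitzOn hδ hf hAc hBc hA hB hAB
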